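/- Let $G$ be a finite group. A bijection $\sigma\colon G\to G$ is called a *colouring bijection* if the three maps $x\mapsto\sigma(x)x$, $x\mapsto x^{-1}\sigma(x)$ and $x\mapsto x^{-1}\sigma(x)x$ are also bijections of $G$. Let $\mathscr G_3(G)=\mathrm{Cay}(G^3,\mathbf S_3)$ be the Cayley graph of $G^3$ with connection set $$\mathbf S_3=\{(g,e,e),(e,g,e),(e,e,g),(g,g,e),(e,g,g),(g,g,g)\mid g\in G\setminus\{e\}\},$$ in which the neighbours of $u\in G^3$ are the elements $su$ with $s\in\mathbf S_3$. For $r\ge 4$ let $$L_r=\langle a,b\mid a^{3^{r-1}}=b^3=1,\ bab^{-1}=a^{1+3^{r-2}}\rangle .$$ Let $G$ be a finite $3$-group. 1. If $G$ is not cyclic and is not isomorphic to $L_r$ for any $r\ge4$, then $G$ admits a colouring bijection, and the chromatic number of $\mathscr G_3(G)$ is $\chi(\mathscr G_3(G))=|G|$. 2. Moreover, if no maximal subgroup of $G$ is cyclic, then $G$ admits a colouring bijection and $\chi(\mathscr G_3(G))=|G|$. -/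

import Mathlib

/-- A bijection `σ : G → G` is a colouring bijection if the three maps
`x ↦ σ(x) x`, `x ↦ x⁻¹ σ(x)` and `x ↦ x⁻¹ σ(x) x` are bijections of `G` as well. -/
structure IsColouringBijection {G : Type*} [Group G] (σ : G → G) : Prop where
  bijective : Function.Bijective σ
  bijective_mul : Function.Bijective fun x => σ x * x
  bijective_inv_mul : Function.Bijective fun x => x⁻¹ * σ x
  bijective_conj : Function.Bijective fun x => x⁻¹ * σ x * x

/-- A group is colourable if it admits a colouring bijection. -/
def IsColourableGroup (G : Type*) [Group G] : Prop :=
  ∃ σ : G → G, IsColouringBijection σ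

/-- The (left) Cayley graph `Cay(Γ, S)`: distinct vertices `u`, `v` are adjacent if one of them is
obtained from the other by left multiplication by an element of `S`. -/
def leftCayleyGraph {Γ : Type*} [Group Γ] (S : Set Γ) : SimpleGraph Γ :=
  SimpleGraph.fromRel fun u v => ∃ s ∈ S, v = s * u

/-- The connection set
`{(g,e,e), (e,g,e), (e,e,g), (g,g,e), (e,g,g), (g,g,g) | g ∈ G, g ≠ e}` in `G³`. -/
def connectionSet3 (G : Type*) [Group G] : Set (G × G × G) :=
  {s | ∃ g : G, g ≠ 1 ∧
    (s = (g, 1, 1) ∨ s = (1, g, 1) ∨ s = (1, 1, g) ∨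
      s = (g, g, 1) ∨ s = (1, g, g) ∨ s = (g, g, g))}

/-- The Cayley graph `𝒢₃(G)` on the group `G³`. -/
def cayleyGraph3 (G : Type*) [Group G] : SimpleGraph (G × G × G) :=
  leftCayleyGraph (connectionSet3 G)

/-- The relators of the presentation
`⟨a, b ∣ a ^ 3^(r-1) = b ^ 3 = 1, b a b⁻¹ = a ^ (1 + 3^(r-2))⟩`, where `a` and `b` are the free
generators with index `0` and `1`. It is used for `r ≥ 4` only. -/
def relatorsL (r : ℕ) : Set (FreeGroup (Fin 2)) :=
  {FreeGroup.of 0 ^ 3 ^ (r - 1),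
    FreeGroup.of 1 ^ 3,
    FreeGroup.of 1 * FreeGroup.of 0 * (FreeGroup.of 1)⁻¹ *
      (FreeGroup.of 0 ^ (1 + 3 ^ (r - 2)))⁻¹}

/-- The group `L_r = ⟨a, b ∣ a ^ 3^(r-1) = b ^ 3 = 1, b a b⁻¹ = a ^ (1 + 3^(r-2))⟩`. -/
abbrev GroupL (r : ℕ) : Type := PresentedGroup (relatorsL r)

/-!
A colouring bijection `σ` of `G` yields the proper colouring `(x, y, z) ↦ z⁻¹ σ(y) x` of `𝒢₃(G)`
with `|G|` colours, and the elements `(g, 1, 1)` form a clique, so it suffices to find colouring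
bijections. A group isomorphic to `L_r` has a cyclic maximal subgroup, so the second assertion is a
case of the first one.

Colouring bijections are lifted from quotients `G ⧸ N` (`IsColourableGroup.of_quotient`): if `s` and
`t` represent a coset and its image, then `s n ↦ t ν(n)` works for a map `ν` of `N` adapted to the
actions of `s` and `t⁻¹ s` on `N`. The normal subgroups used are those of the form `C_{3^(k+1)} × C_3`
generated by a central element `c` and an element `y` on which `G` acts by shears
(`AdmissiblePair`). For `k = 0` the maps `ν` are linear; for `k > 0` no affine map works, and a map
is built from a step function (`hasTwistedMappings_of_dvd`). So colourings extend from the quotient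
by any such subgroup (`AdmissiblePair.isColourableGroup`).

Every noncyclic `3`-group has a normal subgroup `N` of type `C_3 × C_3` generated by such a pair
(`exists_admissiblePair`), and one argues by induction on the order. It remains to treat groups for
which `G ⧸ N` is cyclic or isomorphic to some `L_r`.

* If `G ⧸ N` is cyclic, then `G` has order `27` (three groups, settled by explicit bijections), or
  it is abelian with two generators and itself of the form `C_{3^(k+1)} × C_3`, or it is isomorphic
  to some `L_r`, or it has another central subgroup of type `C_3 × C_3` with a noncyclic abelian
  quotient.
* If `G ⧸ N` is isomorphic to `L_r`, then there is a normal subgroup of type `C_3 × C_3` or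
  `C_9 × C_3` with a noncyclic abelian quotient
  (`AdmissiblePair.isColourableGroup_of_isModularGroup`).
-/

universe u

/-! ### The chromatic number of `𝒢₃(G)` -/

theorem cayleyGraph3_adj {G : Type*} [Group G] {u v : G × G × G} :
    (cayleyGraph3 G).Adj u v ↔
      u ≠ v ∧ ((∃ s ∈ connectionSet3 G, v = s * u) ∨ ∃ s ∈ connectionSet3 G, u = s * v) :=
  Iff.rfl

/-- The elements `(g, 1, 1)` form a clique of `𝒢₃(G)` with `|G|` elements. -/
theorem card_le_chromaticNumber_cayleyGraph3 (G : Type*) [Group G] [Finite G] :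
    (Nat.card G : ℕ∞) ≤ (cayleyGraph3 G).chromaticNumber := by
  classical
  have := Fintype.ofFinite G
  have hinj : Function.Injective fun g : G => ((g, 1, 1) : G × G × G) := fun a b h => by
    simpa using h
  have hcl : (cayleyGraph3 G).IsClique
      ((Finset.univ.image fun g : G => ((g, 1, 1) : G × G × G) : Finset _) : Set (G × G × G)) := by
    intro u hu v hv huv
    simp only [Finset.coe_image, Finset.coe_univ, Set.image_univ, Set.mem_range] at hu hv
    obtain ⟨g, rfl⟩ := hu
    obtain ⟨h, rfl⟩ := hv
    refine cayleyGraph3_adj.2 ⟨huv, Or.inl ⟨(h * g⁻¹, 1, 1), ⟨h * g⁻¹, ?_, Or.inl rfl⟩, ?_⟩⟩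
    · intro hh
      exact huv (by rw [mul_inv_eq_one.1 hh])
    · simp
  have := hcl.card_le_chromaticNumber
  rwa [Finset.card_image_of_injective _ hinj, Finset.card_univ, ← Nat.card_eq_fintype_card] at this

/-- A colouring bijection `σ` yields the proper colouring `(x, y, z) ↦ z⁻¹ σ(y) x`: moving a vertex
along one of the six types of generators changes this colour because one of `x`, `z⁻¹`, `σ(y)`,
`σ(y) y`, `y⁻¹ σ(y)`, `y⁻¹ σ(y) y` changes while the remaining factors do not. -/
theorem IsColouringBijection.mul_ne {G : Type*} [Group G] {σ : G → G} (hσ : IsColouringBijection σ)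
    {s : G × G × G} (hs : s ∈ connectionSet3 G) (u : G × G × G) :
    (s * u).2.2⁻¹ * σ (s * u).2.1 * (s * u).1 ≠ u.2.2⁻¹ * σ u.2.1 * u.1 := by
  obtain ⟨x, y, z⟩ := u
  obtain ⟨g, hg, hs⟩ := hs
  have hgy : g * y ≠ y := by simpa using hg
  rcases hs with rfl | rfl | rfl | rfl | rfl | rfl <;>
    simp only [Prod.mk_mul_mk, one_mul, ne_eq]
  · intro h
    exact hg (by simpa using h)
  · intro h
    exact hgy (hσ.bijective.1 (mul_left_cancel (mul_right_cancel h)))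
  · intro h
    exact hg (by simpa [mul_assoc] using h)
  · intro h
    refine hgy (hσ.bijective_mul.1 ?_)
    have : (z⁻¹ * σ (g * y) * (g * x)) * (x⁻¹ * y) = (z⁻¹ * σ y * x) * (x⁻¹ * y) := by rw [h]
    simpa [mul_assoc] using this
  · intro h
    refine hgy (hσ.bijective_inv_mul.1 ?_)
    have : (y⁻¹ * z) * ((g * z)⁻¹ * σ (g * y) * x) * x⁻¹ =
      (y⁻¹ * z) * (z⁻¹ * σ y * x) * x⁻¹ := by rw [h]
    simpa [mul_assoc] using this
  · intro h
    refine hgy (hσ.bijective_conj.1 ?_)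
    have : (y⁻¹ * z) * ((g * z)⁻¹ * σ (g * y) * (g * x)) * (x⁻¹ * y) =
      (y⁻¹ * z) * (z⁻¹ * σ y * x) * (x⁻¹ * y) := by rw [h]
    simpa [mul_assoc] using this

theorem IsColourableGroup.chromaticNumber_cayleyGraph3 {G : Type*} [Group G] [Finite G]
    (hG : IsColourableGroup G) : (cayleyGraph3 G).chromaticNumber = (Nat.card G : ℕ∞) := by
  have := Fintype.ofFinite G
  obtain ⟨σ, hσ⟩ := hG
  refine le_antisymm ?_ (card_le_chromaticNumber_cayleyGraph3 G)
  have hC : (cayleyGraph3 G).Coloring G := by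
    refine SimpleGraph.Coloring.mk (fun u => u.2.2⁻¹ * σ u.2.1 * u.1) ?_
    intro u v huv
    rcases (cayleyGraph3_adj.1 huv).2 with ⟨s, hs, rfl⟩ | ⟨s, hs, rfl⟩
    · exact (hσ.mul_ne hs u).symm
    · exact hσ.mul_ne hs v
  rw [Nat.card_eq_fintype_card]
  exact hC.colorable.chromaticNumber_le

/-! ### Extending colourings from a quotient -/

theorem isColourableGroup_of_injective {G : Type*} [Group G] [Finite G] (σ : G → G)
    (h₁ : Function.Injective σ) (h₂ : Function.Injective fun x => σ x * x)
    (h₃ : Function.Injective fun x => x⁻¹ * σ x)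
    (h₄ : Function.Injective fun x => x⁻¹ * σ x * x) : IsColourableGroup G :=
  ⟨σ, Finite.injective_iff_bijective.1 h₁, Finite.injective_iff_bijective.1 h₂,
    Finite.injective_iff_bijective.1 h₃, Finite.injective_iff_bijective.1 h₄⟩

theorem isColourableGroup_of_subsingleton {G : Type*} [Group G] [Subsingleton G] :
    IsColourableGroup G :=
  isColourableGroup_of_injective id (Function.injective_of_subsingleton _)
    (Function.injective_of_subsingleton _) (Function.injective_of_subsingleton _)
    (Function.injective_of_subsingleton _)

/-- A colouring bijection `τ` of `G ⧸ N` lifts to `G` by `s n ↦ t ν(n)`, where `s` and `t` are the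
representatives of a coset and of its image under `τ`, provided that for all `s`, `t` there is a
map `ν` of `N` for which the four maps of a colouring bijection are injective on the coset `s N`. -/
theorem IsColourableGroup.of_quotient {G : Type*} [Group G] [Finite G] (N : Subgroup G) [N.Normal]
    (hQ : IsColourableGroup (G ⧸ N))
    (hν : ∀ s t : G, ∃ ν : N → N, Function.Injective ν ∧
      (Function.Injective fun n : N => t * ν n * (s * n)) ∧
      (Function.Injective fun n : N => (s * n : G)⁻¹ * (t * ν n)) ∧
      Function.Injective fun n : N => (s * n : G)⁻¹ * (t * ν n) * (s * n)) :
    IsColourableGroup G := by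
  obtain ⟨τ, hτ⟩ := hQ
  choose ν hν₁ hν₂ hν₃ hν₄ using hν
  let r : G ⧸ N → G := Quotient.out
  have hr : ∀ q : G ⧸ N, ((r q : G) : G ⧸ N) = q := fun q => Quotient.out_eq q
  let s : G → G := fun x => r x
  let t : G → G := fun x => r (τ x)
  have hs : ∀ x : G, (s x)⁻¹ * x ∈ N := fun x => QuotientGroup.eq.1 (hr x)
  let n : G → N := fun x => ⟨(s x)⁻¹ * x, hs x⟩
  have hx : ∀ x : G, x = s x * n x := fun x => by simp [n]
  let σ : G → G := fun x => t x * ν (s x) (t x) (n x)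
  have hσ : ∀ x : G, (σ x : G ⧸ N) = τ x := fun x => by
    have h1 : ((ν (s x) (t x) (n x) : G) : G ⧸ N) = 1 :=
      (QuotientGroup.eq_one_iff _).2 (ν (s x) (t x) (n x)).2
    simp only [σ, QuotientGroup.mk_mul, h1, mul_one]
    exact hr _
  have key : ∀ x y : G, (x : G ⧸ N) = y → s x = s y ∧ t x = t y := fun x y h =>
    ⟨congrArg r h, congrArg (fun q => r (τ q)) h⟩
  refine isColourableGroup_of_injective σ ?_ ?_ ?_ ?_
  · intro x y hxy
    obtain ⟨h1, h2⟩ := key x y (hτ.bijective.1 (by rw [← hσ, ← hσ, hxy]))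
    have hn : n x = n y := hν₁ (s y) (t y) (Subtype.ext (mul_left_cancel (a := t y) (by
      simpa only [σ, h1, h2] using hxy)))
    rw [hx x, hx y, h1, hn]
  · intro x y hxy
    have hq : (τ x * x : G ⧸ N) = τ y * y := by
      have := congrArg (QuotientGroup.mk (s := N)) hxy
      simpa only [QuotientGroup.mk_mul, hσ] using this
    obtain ⟨h1, h2⟩ := key x y (hτ.bijective_mul.1 hq)
    have hn : n x = n y := by
      refine hν₂ (s y) (t y) ?_
      have h3 : σ x * (s x * n x) = σ y * (s y * n y) := by
        rw [← hx, ← hx]; exact hxy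
      simpa only [σ, h1, h2] using h3
    rw [hx x, hx y, h1, hn]
  · intro x y hxy
    have hq : ((x : G ⧸ N)⁻¹ * τ x : G ⧸ N) = (y : G ⧸ N)⁻¹ * τ y := by
      have := congrArg (QuotientGroup.mk (s := N)) hxy
      simpa only [QuotientGroup.mk_mul, QuotientGroup.mk_inv, hσ] using this
    obtain ⟨h1, h2⟩ := key x y (hτ.bijective_inv_mul.1 hq)
    have hn : n x = n y := by
      refine hν₃ (s y) (t y) ?_
      have h3 : (s x * n x : G)⁻¹ * σ x = (s y * n y : G)⁻¹ * σ y := by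
        rw [← hx, ← hx]; exact hxy
      simpa only [σ, h1, h2] using h3
    rw [hx x, hx y, h1, hn]
  · intro x y hxy
    have hq : ((x : G ⧸ N)⁻¹ * τ x * x : G ⧸ N) = (y : G ⧸ N)⁻¹ * τ y * y := by
      have := congrArg (QuotientGroup.mk (s := N)) hxy
      simpa only [QuotientGroup.mk_mul, QuotientGroup.mk_inv, hσ] using this
    obtain ⟨h1, h2⟩ := key x y (hτ.bijective_conj.1 hq)
    have hn : n x = n y := by
      refine hν₄ (s y) (t y) ?_
      have h3 : (s x * n x : G)⁻¹ * σ x * (s x * n x) = (s y * n y : G)⁻¹ * σ y * (s y * n y) := by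
        rw [← hx, ← hx]; exact hxy
      simpa only [σ, h1, h2] using h3
    rw [hx x, hx y, h1, hn]

/-! ### Twisted strong complete mappings of `ZMod n × ZMod 3` -/

/-- The shear `(x, i) ↦ (x + ψ(k i), i)` of `ZMod n × ZMod 3`. -/
def shear {n : ℕ} (ψ : ZMod 3 →+ ZMod n) (k : ZMod 3) (u : ZMod n × ZMod 3) : ZMod n × ZMod 3 :=
  (u.1 + ψ (k * u.2), u.2)

/-- For any two shears `P_k`, `P_j` there is a map `ν` such that `ν`, `ν + P_k`, `ν - P_j` and
`ν + P_k - P_j` are injective. For `k = j = 0` these are the strong complete mappings. If `s` and `t`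
represent a coset and its image, then `P_k` and `P_j` are conjugation by `s` and by `t⁻¹ s`. -/
def HasTwistedMappings (n : ℕ) (ψ : ZMod 3 →+ ZMod n) : Prop :=
  ∀ k j : ZMod 3, ∃ ν : ZMod n × ZMod 3 → ZMod n × ZMod 3, Function.Injective ν ∧
    (Function.Injective fun u => ν u + shear ψ k u) ∧
    (Function.Injective fun u => ν u - shear ψ j u) ∧
    Function.Injective fun u => ν u + shear ψ k u - shear ψ j u

theorem injective_linear_of_det_ne_zero {p q r s : ZMod 3} (h : p * s - q * r ≠ 0) :
    Function.Injective fun u : ZMod 3 × ZMod 3 => (p * u.1 + q * u.2, r * u.1 + s * u.2) := by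
  rintro ⟨x, y⟩ ⟨x', y'⟩ he
  simp only [Prod.mk.injEq] at he
  have h1 : (p * s - q * r) * (x - x') = 0 := by linear_combination s * he.1 - q * he.2
  have h2 : (p * s - q * r) * (y - y') = 0 := by linear_combination p * he.2 - r * he.1
  exact Prod.ext (sub_eq_zero.1 ((mul_eq_zero.1 h1).resolve_left h))
    (sub_eq_zero.1 ((mul_eq_zero.1 h2).resolve_left h))

/-- On `ZMod 3 × ZMod 3` linear maps with suitable determinant `D` and trace `S` do. -/
theorem hasTwistedMappings_three : HasTwistedMappings 3 (AddMonoidHom.id (ZMod 3)) := by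
  have h : ∀ k j : ZMod 3, ∃ D S : ZMod 3, D ≠ 0 ∧ D + S + 1 - k ≠ 0 ∧ D - S + 1 + j ≠ 0 ∧
      D - k + j ≠ 0 := by
    decide
  intro k j
  obtain ⟨D, S, h1, h2, h3, h4⟩ := h k j
  refine ⟨fun u => (-D * u.2, u.1 + S * u.2), ?_, ?_, ?_, ?_⟩
  · convert injective_linear_of_det_ne_zero (p := 0) (q := -D) (r := 1) (s := S) ?_ using 3
    · ring
    · ring
    · convert h1 using 1; ring
  · convert injective_linear_of_det_ne_zero (p := 1) (q := k - D) (r := 1) (s := S + 1) ?_ using 1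
    · funext u
      ext <;> simp only [shear, AddMonoidHom.id_apply, Prod.fst_add, Prod.snd_add] <;> ring
    · convert h2 using 1; ring
  · convert injective_linear_of_det_ne_zero (p := -1) (q := -D - j) (r := 1) (s := S - 1) ?_ using 1
    · funext u
      ext <;> simp only [shear, AddMonoidHom.id_apply, Prod.fst_sub, Prod.snd_sub] <;> ring
    · convert h3 using 1; ring
  · convert injective_linear_of_det_ne_zero (p := 0) (q := k - j - D) (r := 1) (s := S) ?_ using 1
    · funext u
      ext <;> simp only [shear, AddMonoidHom.id_apply, Prod.fst_sub, Prod.snd_sub, Prod.fst_add,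
        Prod.snd_add] <;> ring
    · convert h4 using 1; ring

/-- The negative of the quotient of the division by `m`, as a function from `ZMod (3 * m)` to
`ZMod 3`: it decreases by `1` over every `m` steps, and each step changes it by `0` or `-1`. -/
def stairs (m : ℕ) (t : ZMod (3 * m)) : ZMod 3 := -((t.val / m : ℕ) : ZMod 3)

theorem stairs_natCast (m x : ℕ) : stairs m (x : ZMod (3 * m)) = -((x / m : ℕ) : ZMod 3) := by
  rw [stairs, ZMod.val_natCast, Nat.mod_mul_left_div_self, ZMod.natCast_mod]

theorem stairs_add_mul {m : ℕ} (hm : 0 < m) (t : ZMod (3 * m)) (e : ℕ) :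
    stairs m (t + (m * e : ℕ)) = stairs m t - e := by
  have : NeZero (3 * m) := ⟨by omega⟩
  obtain ⟨x, rfl⟩ := ZMod.natCast_zmod_surjective t
  rw [← Nat.cast_add, stairs_natCast, stairs_natCast, Nat.add_mul_div_left _ _ hm]
  push_cast
  ring

theorem stairs_add_one {m : ℕ} (hm : 0 < m) (t : ZMod (3 * m)) :
    stairs m (t + 1) = stairs m t ∨ stairs m (t + 1) = stairs m t - 1 := by
  have : NeZero (3 * m) := ⟨by omega⟩
  obtain ⟨x, rfl⟩ := ZMod.natCast_zmod_surjective t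
  rw [← Nat.cast_add_one, stairs_natCast, stairs_natCast, Nat.succ_div]
  split_ifs
  · right; push_cast; ring
  · left; simp

theorem exists_eq_add_of_three_mul_eq {m : ℕ} (hm : 0 < m) {t t' : ZMod (3 * m)}
    (h : 3 * t = 3 * t') : ∃ e : ℕ, t = t' + (m * e : ℕ) := by
  have : NeZero (3 * m) := ⟨by omega⟩
  obtain ⟨x, hx⟩ := ZMod.natCast_zmod_surjective (t - t')
  have h3 : ((3 * x : ℕ) : ZMod (3 * m)) = 0 := by
    push_cast
    rw [hx, mul_sub, h, sub_self]
  rw [ZMod.natCast_eq_zero_iff] at h3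
  obtain ⟨e, rfl⟩ := Nat.dvd_of_mul_dvd_mul_left (by norm_num) h3
  exact ⟨e, by rw [hx]; ring⟩

/-- The second coordinate of the twisted mappings of `ZMod (3 * m) × ZMod 3`. -/
def stairsMap (m : ℕ) (b : ZMod (3 * m)) (t : ZMod (3 * m)) (i : ZMod 3) : ZMod 3 :=
  if i = 0 then -stairs m (t + b) - stairs m (t + b + 1)
  else if i = 1 then stairs m (t + b + b + 1) else stairs m t

theorem stairsMap_injOn {m : ℕ} (hm : 0 < m) (b : ZMod (3 * m)) {t t' : ZMod (3 * m)} (i : ZMod 3)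
    (h : 3 * t = 3 * t') (hs : stairsMap m b t i = stairsMap m b t' i) : t = t' := by
  obtain ⟨e, rfl⟩ := exists_eq_add_of_three_mul_eq hm h
  have he : (e : ZMod 3) = 0 := by
    have hc : ∀ z : ZMod (3 * m), stairs m (t' + (m * e : ℕ) + z) = stairs m (t' + z) - e :=
      fun z => by rw [add_right_comm, stairs_add_mul hm]
    have h2 : ∀ x y z : ZMod 3, -(x - z) - (y - z) = -x - y → z = 0 := by decide
    simp only [stairsMap, add_assoc (t' + _), hc, stairs_add_mul hm] at hs
    split_ifs at hs
    · exact h2 _ _ _ (by simpa only [add_assoc] using hs)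
    · simpa [add_assoc] using hs
    · simpa using hs
  rw [ZMod.natCast_eq_zero_iff] at he
  rw [(ZMod.natCast_eq_zero_iff _ _).2 (by rw [mul_comm]; exact Nat.mul_dvd_mul_left m he),
    add_zero]

/-- The lift of `ZMod 3` to `{0, 1, -1}` in `ZMod n`. -/
def signLift (n : ℕ) (i : ZMod 3) : ZMod n := if i = 0 then 0 else if i = 1 then 1 else -1

/-- For `m` a multiple of `3`, with `n = 3 m` odd, the mappings `ν(t, i) = (3 t + a_i, G_i(t))` do,
where `a_i ≡ i` modulo `3` and `G_i` is built from the step function `stairs m`. The first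
coordinates of `ν ± P` are of the form `4 t + 4 b_i` and `2 t + 2 c_i`, and at `t = p - b_i` as well
as at `t = p - c_i` the three second coordinates are, up to order, `-u - v`, `v + 1` and `u - 1`,
where `u` and `v` are consecutive values of `stairs m`; these are distinct as `v - u ∈ {0, -1}`. -/
theorem hasTwistedMappings_of_dvd {m : ℕ} (hm : 0 < m) (hodd : Odd m) (h3 : 3 ∣ m)
    (ψ : ZMod 3 →+ ZMod (3 * m)) : HasTwistedMappings (3 * m) ψ := by
  have : NeZero (3 * m) := ⟨by omega⟩
  have hψ3 : ∀ x, 3 * ψ x = 0 := fun x => by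
    have : (3 : ℕ) • ψ x = 0 := by rw [← map_nsmul]; simp [show (3 : ZMod 3) = 0 from rfl]
    simpa using this
  have h2 : ∀ x : ZMod (3 * m), 2 * x = 0 → x = 0 := fun x hx => by
    have : IsUnit ((2 : ℕ) : ZMod (3 * m)) := by
      rw [ZMod.isUnit_iff_coprime, Nat.coprime_two_left]
      exact Odd.mul (by decide) hodd
    exact (this.mul_right_eq_zero).1 (by simpa using hx)
  let π : ZMod (3 * m) →+* ZMod 3 := ZMod.castHom (Dvd.intro m rfl) (ZMod 3)
  have hπψ : ∀ x, π (ψ x) = 0 := fun x => by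
    obtain ⟨e, he⟩ := exists_eq_add_of_three_mul_eq (t := ψ x) (t' := 0) hm (by rw [hψ3, mul_zero])
    rw [he, zero_add, map_natCast, ZMod.natCast_eq_zero_iff]
    exact h3.mul_right e
  have hπε : ∀ i, π (signLift (3 * m) i) = i := by
    have : ∀ i : ZMod 3, i ≠ 0 → i ≠ 1 → -1 = i := by decide
    intro i
    unfold signLift
    split_ifs with h0 h1
    · rw [map_zero, h0]
    · rw [map_one, h1]
    · rw [map_neg, map_one, this i h0 h1]
  intro k j
  let ε := signLift (3 * m)
  -- The shears contribute `ψ (k i)` and `ψ (j i)` to the first coordinates; this choice of `a_i` makes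
  -- `b_i = ε_i b` and `c_i = ε_i (b + 1)`, where `4 ψ = ψ` and `2 ψ = -ψ` because `3 ψ = 0`.
  let d := ψ (j + k)
  let b : ZMod (3 * m) := 1 - d
  let a : ZMod 3 → ZMod (3 * m) := fun i => 4 * ε i + ψ ((2 * j + k) * i)
  have hπa : ∀ i, π (a i) = i := fun i => by
    simp only [a, map_add, map_mul, hπψ, ε, hπε, add_zero]
    have : (π 4 : ZMod 3) = 1 := by rw [map_ofNat]; rfl
    rw [this, one_mul]
  have hψε : ∀ x i, ψ (x * i) = ψ x * ε i := by
    have : ∀ i : ZMod 3, i ≠ 0 → i ≠ 1 → i = -1 := by decide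
    intro x i
    simp only [ε, signLift]
    split_ifs with h0 h1
    · simp [h0]
    · simp [h1]
    · rw [this i h0 h1, mul_neg_one, mul_neg_one, map_neg]
  have hG : ∀ (p : ZMod (3 * m)) (i i' : ZMod 3),
      (stairsMap m b (p - ε i * b) i + i = stairsMap m b (p - ε i' * b) i' + i' → i = i') ∧
      (stairsMap m b (p - ε i * (b + 1)) i - i = stairsMap m b (p - ε i' * (b + 1)) i' - i' →
        i = i') := by
    intro p i i'
    have hB : ∀ i, stairsMap m b (p - ε i * b) i + i =
        if i = 0 then -stairs m (p + b) - stairs m (p + b + 1)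
        else if i = 1 then stairs m (p + b + 1) + 1 else stairs m (p + b) - 1 := by
      have : ∀ x i : ZMod 3, i ≠ 0 → i ≠ 1 → x + i = x - 1 := by decide
      intro i
      simp only [stairsMap, ε, signLift]
      split_ifs with h0 h1
      · simp [h0]
      · simp [h1]
      · rw [this _ i h0 h1, neg_one_mul, sub_neg_eq_add]
    have hC : ∀ i, stairsMap m b (p - ε i * (b + 1)) i - i =
        if i = 0 then -stairs m (p + b) - stairs m (p + b + 1)
        else if i = 1 then stairs m (p + b) - 1 else stairs m (p + b + 1) + 1 := by
      have : ∀ x i : ZMod 3, i ≠ 0 → i ≠ 1 → x - i = x + 1 := by decide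
      intro i
      simp only [stairsMap, ε, signLift]
      split_ifs with h0 h1
      · simp [h0]
      · rw [h1]; congr 2; ring
      · rw [this _ i h0 h1]; congr 2; ring
    rw [hB, hB, hC, hC]
    have hd : ∀ u v i i' : ZMod 3, v = u ∨ v = u - 1 →
        ((if i = 0 then -u - v else if i = 1 then v + 1 else u - 1) =
          (if i' = 0 then -u - v else if i' = 1 then v + 1 else u - 1) → i = i') ∧
        ((if i = 0 then -u - v else if i = 1 then u - 1 else v + 1) =
          (if i' = 0 then -u - v else if i' = 1 then u - 1 else v + 1) → i = i') := by
      decide +kernel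
    exact hd _ _ i i' (stairs_add_one hm (p + b))
  have h0 : ∀ x : ZMod 3, Function.Injective fun u : ZMod (3 * m) × ZMod 3 =>
      (3 * u.1 + a u.2 + ψ (x * u.2), stairsMap m b u.1 u.2) := by
    rintro x ⟨t, i⟩ ⟨t', i'⟩ h
    simp only [Prod.mk.injEq] at h
    have hi : i = i' := by
      have := congrArg π h.1
      have h30 : (π 3 : ZMod 3) = 0 := by rw [map_ofNat]; rfl
      simpa [hπa, hπψ, h30] using this
    subst hi
    rw [stairsMap_injOn hm b i (by simpa using h.1) h.2]
  have hpsi : ψ (2 * j + k) = 2 * ψ j + ψ k := by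
    rw [two_mul, map_add, map_add]; ring
  have hdd : d = ψ j + ψ k := map_add _ _ _
  refine ⟨fun u => (3 * u.1 + a u.2, stairsMap m b u.1 u.2), ?_, ?_, ?_, ?_⟩
  · simpa using h0 0
  · rintro ⟨t, i⟩ ⟨t', i'⟩ h
    simp only [shear, Prod.mk_add_mk, Prod.mk.injEq] at h
    have hb : ∀ (t : ZMod (3 * m)) i, 3 * t + a i + (t + ψ (k * i)) = 2 * (2 * (t + ε i * b)) := by
      intro t i
      simp only [a, hψε, hpsi, b, hdd]
      linear_combination 2 * ε i * (hψ3 j + hψ3 k)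
    have hp : t + ε i * b = t' + ε i' * b := by
      rw [hb, hb] at h
      refine sub_eq_zero.1 (h2 _ (h2 _ ?_))
      linear_combination h.1
    have hi : i = i' := by
      refine (hG (t + ε i * b) i i').1 ?_
      have e2 : t + ε i * b - ε i' * b = t' := by rw [hp]; ring
      rw [e2, add_sub_cancel_right]
      exact h.2
    subst hi
    rw [add_right_cancel hp]
  · rintro ⟨t, i⟩ ⟨t', i'⟩ h
    simp only [shear, Prod.mk_sub_mk, Prod.mk.injEq] at h
    have hb : ∀ (t : ZMod (3 * m)) i,
        3 * t + a i - (t + ψ (j * i)) = 2 * (t + ε i * (b + 1)) := by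
      intro t i
      simp only [a, hψε, hpsi, b, hdd]
      linear_combination ε i * (hψ3 j + hψ3 k)
    have hp : t + ε i * (b + 1) = t' + ε i' * (b + 1) := by
      rw [hb, hb] at h
      refine sub_eq_zero.1 (h2 _ ?_)
      linear_combination h.1
    have hi : i = i' := by
      refine (hG (t + ε i * (b + 1)) i i').2 ?_
      have e2 : t + ε i * (b + 1) - ε i' * (b + 1) = t' := by rw [hp]; ring
      rw [e2, add_sub_cancel_right]
      exact h.2
    subst hi
    rw [add_right_cancel hp]
  · convert h0 (k - j) using 1
    funext u
    simp only [shear, sub_mul, map_sub]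
    ext
    · simp only [Prod.fst_add, Prod.fst_sub]; ring
    · simp

/-- The twisted mappings for the shears of `ZMod (3 ^ (k + 1)) × ZMod 3` along the subgroup of
order `3` of the first factor. -/
theorem exists_hasTwistedMappings (k : ℕ) : ∃ ψ : ZMod 3 →+ ZMod (3 ^ (k + 1)),
    (∀ p : ℕ, ψ p = ((3 ^ k * p : ℕ) : ZMod (3 ^ (k + 1)))) ∧
      HasTwistedMappings (3 ^ (k + 1)) ψ := by
  rcases k with _ | k
  · exact ⟨AddMonoidHom.id (ZMod 3), fun p => by simp, hasTwistedMappings_three⟩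
  · rw [show 3 ^ (k + 1 + 1) = 3 * 3 ^ (k + 1) by ring]
    let f : ℤ →+ ZMod (3 * 3 ^ (k + 1)) := zmultiplesHom _ ((3 ^ (k + 1) : ℕ) : ZMod _)
    have hf : f (3 : ℕ) = 0 := by
      simp only [f, zmultiplesHom_apply, natCast_zsmul, nsmul_eq_mul, ← Nat.cast_mul]
      exact ZMod.natCast_self _
    refine ⟨ZMod.lift 3 ⟨f, hf⟩, fun p => ?_, hasTwistedMappings_of_dvd (by positivity)
      (Odd.pow (by decide)) (Dvd.intro_left _ rfl) _⟩
    have : ZMod.lift 3 ⟨f, hf⟩ ((p : ℤ) : ZMod 3) = f p := ZMod.lift_coe _ _ _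
    rw [Int.cast_natCast] at this
    rw [this]
    simp [f, mul_comm]

/-! ### Normal subgroups of type `C_{3^(k+1)} × C_3` -/

/-- A central element `c` of order `3 ^ (k + 1)` and an element `y` of order `3` outside `⟨c⟩` whose
conjugates lie in `y ⟨c ^ 3 ^ k⟩`. They generate a normal subgroup of `G` of type
`C_{3^(k+1)} × C_3`, on which `G` acts by shears. -/
structure AdmissiblePair {G : Type*} [Group G] (k : ℕ) (c y : G) : Prop where
  orderOf_left : orderOf c = 3 ^ (k + 1)
  commute : ∀ g, Commute g c
  pow_three : y ^ 3 = 1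
  notMem : y ∉ Subgroup.zpowers c
  conj : ∀ g, ∃ p : ℕ, g * y * g⁻¹ = y * c ^ (3 ^ k * p)

namespace AdmissiblePair

variable {G : Type*} [Group G] {k : ℕ} {c y : G}

/-- The parametrization `(x, i) ↦ c ^ x * y ^ i` of the subgroup generated by `c` and `y`. -/
def param (k : ℕ) (c y : G) (u : ZMod (3 ^ (k + 1)) × ZMod 3) : G := c ^ u.1.val * y ^ u.2.val

theorem param_natCast (h : AdmissiblePair k c y) (x i : ℕ) :
    param k c y (x, i) = c ^ x * y ^ i := by
  have hc : c ^ (x % 3 ^ (k + 1)) = c ^ x := by rw [← h.orderOf_left, pow_mod_orderOf]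
  simp only [param, ZMod.val_natCast, hc]
  rw [← pow_eq_pow_mod i h.pow_three]

theorem exists_natCast_eq {n m : ℕ} [NeZero n] [NeZero m] (u : ZMod n × ZMod m) :
    ∃ x i : ℕ, u = ((x : ZMod n), (i : ZMod m)) :=
  ⟨u.1.val, u.2.val, by simp⟩

theorem param_add (h : AdmissiblePair k c y) (u v) :
    param k c y (u + v) = param k c y u * param k c y v := by
  obtain ⟨x, i, rfl⟩ := exists_natCast_eq u
  obtain ⟨x', i', rfl⟩ := exists_natCast_eq v
  rw [Prod.mk_add_mk, ← Nat.cast_add, ← Nat.cast_add, h.param_natCast, h.param_natCast,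
    h.param_natCast, pow_add, pow_add]
  have : y ^ i * c ^ x' = c ^ x' * y ^ i := ((h.commute (y ^ i)).pow_right x').eq
  rw [mul_assoc, mul_assoc, ← mul_assoc (c ^ x'), ← this, mul_assoc]

theorem param_zero : param k c y 0 = 1 := by simp [param]

theorem param_neg (h : AdmissiblePair k c y) (u) : param k c y (-u) = (param k c y u)⁻¹ := by
  rw [eq_inv_iff_mul_eq_one, ← h.param_add, neg_add_cancel, param_zero]

theorem param_sub (h : AdmissiblePair k c y) (u v) :
    param k c y (u - v) = param k c y u * (param k c y v)⁻¹ := by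
  rw [sub_eq_add_neg, h.param_add, h.param_neg]

theorem param_injective (h : AdmissiblePair k c y) : Function.Injective (param k c y) := by
  have key : ∀ u, param k c y u = 1 → u = 0 := by
    rintro ⟨x, i⟩ hu
    have hy : y ^ i.val ∈ Subgroup.zpowers c := by
      rw [eq_inv_of_mul_eq_one_right hu]
      exact inv_mem (pow_mem (Subgroup.mem_zpowers c) _)
    have hi : i = 0 := by
      have hcases : ∀ i : ZMod 3, i = 0 ∨ i.val = 1 ∨ i.val = 2 := by decide
      rcases hcases i with hi | hi | hi
      · exact hi
      · rw [hi, pow_one] at hy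
        exact (h.notMem hy).elim
      · rw [hi] at hy
        refine (h.notMem ?_).elim
        have := mul_mem hy hy
        rwa [← pow_add, show 2 + 2 = 3 + 1 by rfl, pow_succ, h.pow_three, one_mul] at this
    subst hi
    simp only [param, ZMod.val_zero, pow_zero, mul_one] at hu
    have hd := orderOf_dvd_of_pow_eq_one hu
    rw [h.orderOf_left] at hd
    rw [← ZMod.natCast_eq_zero_iff, ZMod.natCast_zmod_val] at hd
    rw [hd]
    rfl
  intro u v huv
  refine sub_eq_zero.1 (key _ ?_)
  rw [h.param_sub, huv, mul_inv_cancel]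

theorem param_conj (h : AdmissiblePair k c y) {ψ : ZMod 3 →+ ZMod (3 ^ (k + 1))}
    (hψ : ∀ p : ℕ, ψ p = ((3 ^ k * p : ℕ) : ZMod (3 ^ (k + 1)))) {g : G} {p : ℕ}
    (hp : g * y * g⁻¹ = y * c ^ (3 ^ k * p)) (u) :
    g * param k c y u * g⁻¹ = param k c y (shear ψ p u) := by
  obtain ⟨x, i, rfl⟩ := exists_natCast_eq u
  have e : shear ψ p ((x : ZMod (3 ^ (k + 1))), (i : ZMod 3)) =
      (((x + 3 ^ k * (p * i) : ℕ) : ZMod (3 ^ (k + 1))), (i : ZMod 3)) := by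
    rw [shear, ← Nat.cast_mul, hψ, ← Nat.cast_add]
  rw [e, h.param_natCast, h.param_natCast]
  have h1 : g * (c ^ x * y ^ i) * g⁻¹ = c ^ x * (g * y * g⁻¹) ^ i := by
    rw [conj_pow, ← mul_assoc, ((h.commute g).pow_right x).eq]
    simp only [mul_assoc]
  rw [h1, hp, ((h.commute y).pow_right _).mul_pow, ((h.commute (y ^ i)).pow_right _).pow_right _ |>.eq,
    ← mul_assoc, ← pow_mul, ← pow_add, mul_assoc (3 ^ k)]

/-- The subgroup generated by an admissible pair, as the image of `param`. -/
def subgroup (h : AdmissiblePair k c y) : Subgroup G where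
  carrier := Set.range (param k c y)
  mul_mem' := by
    rintro _ _ ⟨u, rfl⟩ ⟨v, rfl⟩
    exact ⟨u + v, h.param_add u v⟩
  one_mem' := ⟨0, param_zero⟩
  inv_mem' := by
    rintro _ ⟨u, rfl⟩
    exact ⟨-u, h.param_neg u⟩

theorem mem_subgroup (h : AdmissiblePair k c y) {g : G} :
    g ∈ h.subgroup ↔ ∃ x i : ℕ, g = c ^ x * y ^ i := by
  constructor
  · rintro ⟨u, rfl⟩
    exact ⟨_, _, rfl⟩
  · rintro ⟨x, i, rfl⟩
    exact ⟨_, h.param_natCast x i⟩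

theorem left_mem (h : AdmissiblePair k c y) : c ∈ h.subgroup :=
  h.mem_subgroup.2 ⟨1, 0, by simp⟩

theorem right_mem (h : AdmissiblePair k c y) : y ∈ h.subgroup :=
  h.mem_subgroup.2 ⟨0, 1, by simp⟩

instance normal_subgroup (h : AdmissiblePair k c y) : h.subgroup.Normal := by
  obtain ⟨ψ, hψ, -⟩ := exists_hasTwistedMappings k
  refine ⟨?_⟩
  rintro _ ⟨u, rfl⟩ g
  obtain ⟨p, hp⟩ := h.conj g
  rw [h.param_conj hψ hp]
  exact ⟨_, rfl⟩

theorem card_subgroup (h : AdmissiblePair k c y) : Nat.card h.subgroup = 3 ^ (k + 2) := by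
  have e := Nat.card_congr (Equiv.ofInjective _ h.param_injective)
  rw [Nat.card_prod, Nat.card_zmod, Nat.card_zmod, ← pow_succ] at e
  exact e.symm

/-- Colourings extend from the quotient by the subgroup generated by an admissible pair. -/
theorem isColourableGroup [Finite G] (h : AdmissiblePair k c y)
    (hQ : IsColourableGroup (G ⧸ h.subgroup)) : IsColourableGroup G := by
  obtain ⟨ψ, hψ, hT⟩ := exists_hasTwistedMappings k
  refine IsColourableGroup.of_quotient h.subgroup hQ fun s t => ?_
  obtain ⟨p, hp⟩ := h.conj s
  obtain ⟨q, hq⟩ := h.conj (t⁻¹ * s)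
  obtain ⟨ν, h1, h2, h3, h4⟩ := hT p q
  let e : ZMod (3 ^ (k + 1)) × ZMod 3 ≃ h.subgroup := Equiv.ofInjective _ h.param_injective
  have he : ∀ u, ((e u : h.subgroup) : G) = param k c y u := fun u => rfl
  have hs : ∀ u, param k c y (shear ψ p u) = s * param k c y u * s⁻¹ := fun u =>
    (h.param_conj hψ hp u).symm
  have ht : ∀ u, param k c y (shear ψ q u) = t⁻¹ * s * param k c y u * (t⁻¹ * s)⁻¹ := fun u =>
    (h.param_conj hψ hq u).symm
  have hcomm : ∀ u v, param k c y u * param k c y v = param k c y v * param k c y u := fun u v => by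
    rw [← h.param_add, add_comm, h.param_add]
  refine ⟨fun n => e (ν (e.symm n)), e.injective.comp (h1.comp e.symm.injective), ?_, ?_, ?_⟩
  -- Each of the three maps is, up to multiplication by constants, the image under `param` of one
  -- of the three injective maps attached to `ν`.
  · have : ∀ u, t * (e (ν u) : G) * (s * e u) = t * param k c y (ν u + shear ψ p u) * s := by
      intro u
      rw [h.param_add, hs, he, he]
      group
    intro m n hmn
    obtain ⟨u, rfl⟩ := e.surjective m
    obtain ⟨v, rfl⟩ := e.surjective n
    simp only [Equiv.symm_apply_apply, this, mul_left_inj, mul_right_inj] at hmn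
    rw [h2 (h.param_injective hmn)]
  · have : ∀ u, (s * e u : G)⁻¹ * (t * e (ν u)) = s⁻¹ * t * param k c y (ν u - shear ψ q u) := by
      intro u
      rw [h.param_sub, ← h.param_neg, hcomm, h.param_neg, ht, he, he]
      group
    intro m n hmn
    obtain ⟨u, rfl⟩ := e.surjective m
    obtain ⟨v, rfl⟩ := e.surjective n
    simp only [Equiv.symm_apply_apply, this, mul_right_inj] at hmn
    rw [h3 (h.param_injective hmn)]
  · have : ∀ u, (s * e u : G)⁻¹ * (t * e (ν u)) * (s * e u) =
        s⁻¹ * t * param k c y (ν u + shear ψ p u - shear ψ q u) * s := by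
      intro u
      rw [h.param_sub, ← h.param_neg, hcomm, h.param_add, h.param_neg, hs, ht, he, he]
      group
    intro m n hmn
    obtain ⟨u, rfl⟩ := e.surjective m
    obtain ⟨v, rfl⟩ := e.surjective n
    simp only [Equiv.symm_apply_apply, this, mul_left_inj, mul_right_inj] at hmn
    rw [h4 (h.param_injective hmn)]

end AdmissiblePair

/-! ### Elementary facts on elements of order three and central elements -/

section Elementary

variable {G : Type*} [Group G]

theorem normal_zpowers_of_commute {z : G} (hz : ∀ g, Commute g z) :
    (Subgroup.zpowers z).Normal := by
  refine ⟨fun n hn g => ?_⟩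
  obtain ⟨i, rfl⟩ := hn
  have := ((hz g).zpow_right i).eq
  simp [this]

theorem mem_zpowers_iff_exists_natPow [Finite G] {z x : G} :
    x ∈ Subgroup.zpowers z ↔ ∃ i : ℕ, x = z ^ i := by
  rw [← mem_powers_iff_mem_zpowers, Submonoid.mem_powers_iff]
  exact exists_congr fun _ => eq_comm

theorem pow_three_eq_one_of_mem_zpowers {z x : G} (hz : z ^ 3 = 1)
    (hx : x ∈ Subgroup.zpowers z) : x ^ 3 = 1 := by
  obtain ⟨i, rfl⟩ := hx
  change (z ^ i) ^ 3 = 1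
  rw [← zpow_natCast, zpow_comm, zpow_natCast, hz, one_zpow]

theorem mem_zpowers_of_mem_zpowers_of_ne_one [Finite G] {z x : G} (hz : z ^ 3 = 1)
    (hx : x ∈ Subgroup.zpowers z) (h1 : x ≠ 1) : z ∈ Subgroup.zpowers x := by
  obtain ⟨i, rfl⟩ := mem_zpowers_iff_exists_natPow.1 hx
  rw [pow_eq_pow_mod i hz] at h1 ⊢
  have : i % 3 < 3 := Nat.mod_lt _ (by norm_num)
  interval_cases i % 3
  · simp at h1
  · simp
  · refine mem_zpowers_iff_exists_natPow.2 ⟨2, ?_⟩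
    rw [← pow_mul, show 2 * 2 = 3 + 1 by rfl, pow_succ, hz, one_mul]

/-- Cubing is multiplicative on two elements with a commutator that commutes with both and has
trivial cube. -/
theorem mul_pow_three_of_commutator {a b v : G} (h : b * a = a * b * v) (ha : Commute v a)
    (hb : Commute v b) (hv : v ^ 3 = 1) : (a * b) ^ 3 = a ^ 3 * b ^ 3 := by
  have h' : ∀ x, b * (a * x) = a * (b * (v * x)) := fun x => by
    rw [← mul_assoc, h]; simp only [mul_assoc]
  have ha' : ∀ x, v * (a * x) = a * (v * x) := fun x => by
    rw [← mul_assoc, ha.eq, mul_assoc]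
  have hb' : ∀ x, v * (b * x) = b * (v * x) := fun x => by
    rw [← mul_assoc, hb.eq, mul_assoc]
  have hv' : v * (v * v) = 1 := by rw [← hv, pow_succ, pow_two, mul_assoc]
  simp only [pow_succ, pow_zero, one_mul, mul_assoc]
  simp only [h', ha', hb', hb.eq]
  simp only [hv', mul_one]

theorem AdmissiblePair.of_orderOf_eq_three [Finite G] {z y : G} (hz : orderOf z = 3)
    (hc : ∀ g, Commute g z) (hy : y ^ 3 = 1) (hyz : y ∉ Subgroup.zpowers z)
    (h : ∀ g, ∃ w ∈ Subgroup.zpowers z, g * y * g⁻¹ = y * w) : AdmissiblePair 0 z y := by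
  refine ⟨by simpa using hz, hc, hy, hyz, fun g => ?_⟩
  obtain ⟨w, hw, e⟩ := h g
  obtain ⟨p, rfl⟩ := mem_zpowers_iff_exists_natPow.1 hw
  exact ⟨p, by simpa using e⟩

theorem exists_central_orderOf_eq_three [Finite G] [Nontrivial G] (hG : IsPGroup 3 G) :
    ∃ z : G, orderOf z = 3 ∧ ∀ g, Commute g z := by
  have : Fact (Nat.Prime 3) := ⟨by norm_num⟩
  have hn := hG.center_nontrivial
  have hd : 3 ∣ Nat.card (Subgroup.center G) := by
    rcases (hG.to_subgroup (Subgroup.center G)).card_eq_or_dvd with h | h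
    · exact absurd h Finite.one_lt_card.ne'
    · exact h
  obtain ⟨z, hz⟩ := exists_prime_orderOf_dvd_card' 3 hd
  exact ⟨z, by rw [Subgroup.orderOf_coe, hz], fun g => Subgroup.mem_center_iff.1 z.2 g⟩

/-- Commutators lie in `K` if the quotient by `H` is cyclic and `H` is central modulo `K`. -/
theorem exists_mul_eq_of_isCyclic_quotient {H K : Subgroup G} [H.Normal] [K.Normal]
    [IsCyclic (G ⧸ H)] (h : ∀ x ∈ H, ∀ g : G, ∃ w ∈ K, g * x = x * g * w) (a b : G) :
    ∃ w ∈ K, a * b = b * a * w := by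
  have hcent : ∀ x : G ⧸ K, x ∈ H.map (QuotientGroup.mk' K) → ∀ g, Commute g x := by
    rintro _ ⟨x, hx, rfl⟩ g
    obtain ⟨g, rfl⟩ := QuotientGroup.mk'_surjective K g
    obtain ⟨w, hw, e⟩ := h x hx g
    have := congrArg (QuotientGroup.mk' K) e
    have hw1 : QuotientGroup.mk' K w = 1 := (QuotientGroup.eq_one_iff w).2 hw
    rwa [map_mul, map_mul, map_mul, hw1, mul_one] at this
  obtain ⟨g, hg⟩ := IsCyclic.exists_generator (α := G ⧸ H)
  obtain ⟨g, rfl⟩ := QuotientGroup.mk'_surjective H g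
  have hrep : ∀ x : G, ∃ (i : ℤ) (n : G), n ∈ H ∧ x = g ^ i * n := fun x => by
    obtain ⟨i, hi⟩ := hg (x : G ⧸ H)
    refine ⟨i, (g ^ i)⁻¹ * x, QuotientGroup.eq.1 ?_, by group⟩
    rw [← hi]; rfl
  obtain ⟨i, m, hm, rfl⟩ := hrep a
  obtain ⟨j, n, hn, rfl⟩ := hrep b
  refine ⟨(g ^ j * n * (g ^ i * m))⁻¹ * (g ^ i * m * (g ^ j * n)), QuotientGroup.eq.1 ?_, by group⟩
  have hm' := hcent _ ⟨m, hm, rfl⟩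
  have hn' := hcent _ ⟨n, hn, rfl⟩
  change QuotientGroup.mk' K _ = QuotientGroup.mk' K _
  simp only [map_mul, map_zpow]
  exact (((Commute.refl _).zpow_zpow _ _).mul_left (hm' _).symm).mul_right
    ((hn' _).mul_left (hn' _)) |>.eq.symm

theorem commute_of_isCyclic_quotient {H : Subgroup G} [H.Normal] [IsCyclic (G ⧸ H)]
    (h : ∀ x ∈ H, ∀ g : G, Commute g x) (a b : G) : Commute a b := by
  obtain ⟨w, hw, e⟩ := exists_mul_eq_of_isCyclic_quotient (H := H) (K := ⊥)
    (fun x hx g => ⟨1, one_mem _, by rw [mul_one]; exact (h x hx g).eq⟩) a b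
  rw [Subgroup.mem_bot] at hw
  rw [hw, mul_one] at e
  exact e

end Elementary

/-! ### Noncyclic `3`-groups contain a normal subgroup of type `C_3 × C_3` -/

/-- The case of a cyclic central quotient. -/
theorem exists_admissiblePair_of_isCyclic_quotient {G : Type*} [Group G] [Finite G]
    (hG : IsPGroup 3 G) (hnc : ¬ IsCyclic G) {z : G} (hz : orderOf z = 3)
    (hc : ∀ g, Commute g z) [(Subgroup.zpowers z).Normal] [IsCyclic (G ⧸ Subgroup.zpowers z)] :
    ∃ z y : G, AdmissiblePair 0 z y := by
  have : Fact (Nat.Prime 3) := ⟨by norm_num⟩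
  have hcomm := commute_of_isCyclic_quotient (H := Subgroup.zpowers z) (fun x hx g => by
    obtain ⟨i, rfl⟩ := hx
    exact (hc g).zpow_right i)
  obtain ⟨t, ht⟩ := IsCyclic.exists_generator (α := G ⧸ Subgroup.zpowers z)
  obtain ⟨t, rfl⟩ := QuotientGroup.mk'_surjective _ t
  have hgen : ∀ x : G, ∃ i : ℤ, t ^ (-i) * x ∈ Subgroup.zpowers z := fun x => by
    obtain ⟨i, hi⟩ := ht (x : G ⧸ Subgroup.zpowers z)
    refine ⟨i, ?_⟩
    rw [zpow_neg]
    refine QuotientGroup.eq.1 ?_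
    rw [← hi]; rfl
  have hzt : z ∉ Subgroup.zpowers t := fun hzt => hnc ⟨t, fun x => by
    obtain ⟨i, hi⟩ := hgen x
    have h1 := (Subgroup.zpowers_le.2 hzt) hi
    have h2 := mul_mem (Subgroup.zpow_mem_zpowers t i) h1
    rwa [zpow_neg, mul_inv_cancel_left] at h2⟩
  obtain ⟨s, hs⟩ := IsPGroup.iff_orderOf.1 hG t
  rcases s with _ | s
  · have ht1 : t = 1 := orderOf_eq_one_iff.1 (by simpa using hs)
    refine (hnc ⟨z, fun x => ?_⟩).elim
    obtain ⟨i, hi⟩ := hgen x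
    rwa [ht1, one_zpow, one_mul] at hi
  · have hy3 : (t ^ 3 ^ s) ^ 3 = 1 := by rw [← pow_mul, ← pow_succ, ← hs, pow_orderOf_eq_one]
    have hy1 : t ^ 3 ^ s ≠ 1 := fun h => by
      have := orderOf_dvd_of_pow_eq_one h
      rw [hs, Nat.pow_dvd_pow_iff_le_right (by norm_num)] at this
      omega
    refine ⟨z, t ^ 3 ^ s, .of_orderOf_eq_three hz hc hy3 (fun hy => hzt ?_) fun g =>
      ⟨1, one_mem _, by rw [(hcomm g _).eq]; group⟩⟩
    exact Subgroup.zpowers_le.2 (pow_mem (Subgroup.mem_zpowers t) _)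
      (mem_zpowers_of_mem_zpowers_of_ne_one (by rw [← hz, pow_orderOf_eq_one]) hy hy1)

/-- The induction step: an admissible pair of the quotient by a central subgroup of order `3` can be
lifted and corrected. -/
theorem AdmissiblePair.exists_of_quotient {G : Type*} [Group G] [Finite G] {z : G}
    (hz : orderOf z = 3) (hc : ∀ g, Commute g z) [(Subgroup.zpowers z).Normal]
    {v₁ v₂ : G ⧸ Subgroup.zpowers z} (h : AdmissiblePair 0 v₁ v₂) :
    ∃ z y : G, AdmissiblePair 0 z y := by
  obtain ⟨v₁, rfl⟩ := QuotientGroup.mk'_surjective _ v₁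
  obtain ⟨v₂, rfl⟩ := QuotientGroup.mk'_surjective _ v₂
  set Z := Subgroup.zpowers z with hZ
  have hz3 : z ^ 3 = 1 := by rw [← hz, pow_orderOf_eq_one]
  have hZc : ∀ w ∈ Z, ∀ g, Commute w g := by
    rintro _ ⟨i, rfl⟩ g
    exact ((hc g).zpow_right i).symm
  have hZ3 : ∀ w ∈ Z, w ^ 3 = 1 := fun w hw => pow_three_eq_one_of_mem_zpowers hz3 hw
  have f1 : ∀ g, ∃ w ∈ Z, g * v₁ * g⁻¹ = v₁ * w := fun g => by
    refine ⟨v₁⁻¹ * (g * v₁ * g⁻¹), QuotientGroup.eq.1 ?_, by group⟩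
    have := h.commute (g : G ⧸ Z)
    exact (mul_inv_eq_of_eq_mul this.eq).symm
  have f1' : ∀ g (i : ℤ), ∃ w ∈ Z, g * v₁ ^ i * g⁻¹ = v₁ ^ i * w := fun g i => by
    obtain ⟨w, hw, e⟩ := f1 g
    refine ⟨w ^ i, zpow_mem hw i, ?_⟩
    rw [← conj_zpow, e, (hZc w hw v₁).symm.mul_zpow]
  have f2 : v₁ ^ 3 ∈ Z := (QuotientGroup.eq_one_iff _).1 (by
    have := pow_orderOf_eq_one (QuotientGroup.mk' Z v₁)
    rwa [h.orderOf_left] at this)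
  have f2' : v₁ ∉ Z := fun hv => by
    have h1 : QuotientGroup.mk' Z v₁ = 1 := (QuotientGroup.eq_one_iff _).2 hv
    have := h.orderOf_left
    rw [h1, orderOf_one] at this
    norm_num at this
  have f3 : v₂ ^ 3 ∈ Z := (QuotientGroup.eq_one_iff _).1 h.pow_three
  have f4 : ∀ g, ∃ p : ℕ, ∃ w ∈ Z, g * v₂ * g⁻¹ = v₂ * v₁ ^ p * w := fun g => by
    obtain ⟨p, hp⟩ := h.conj (g : G ⧸ Z)
    refine ⟨p, (v₂ * v₁ ^ p)⁻¹ * (g * v₂ * g⁻¹), QuotientGroup.eq.1 ?_, by group⟩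
    rw [pow_zero, one_mul] at hp
    exact hp.symm
  have f5 : ∀ i : ℤ, v₂ * v₁ ^ i ∉ Z := fun i hi => h.notMem ⟨-i, by
    have : QuotientGroup.mk' Z (v₂ * v₁ ^ i) = 1 := (QuotientGroup.eq_one_iff _).2 hi
    rw [map_mul, map_zpow] at this
    change _ ^ (-i) = _
    rw [zpow_neg, eq_inv_of_mul_eq_one_left this]⟩
  by_cases h1 : v₁ ^ 3 = 1
  · exact ⟨z, v₁, .of_orderOf_eq_three hz hc h1 f2' f1⟩
  obtain ⟨f, hf⟩ := (Subgroup.zpowers_le.2 (mem_zpowers_of_mem_zpowers_of_ne_one hz3 f2 h1)) f3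
  have hf : (v₁ ^ 3) ^ f = v₂ ^ 3 := hf
  have hy3 : (v₂ * v₁ ^ (-f)) ^ 3 = 1 := by
    obtain ⟨w, hw, e⟩ := f1' v₂⁻¹ (-f)
    rw [mul_pow_three_of_commutator (v := w) _ (hZc w hw _) (hZc w hw _) (hZ3 w hw), ← hf,
      ← zpow_natCast (v₁ ^ (-f)), zpow_comm, zpow_natCast, ← zpow_add, add_neg_cancel, zpow_zero]
    rw [mul_assoc, ← e]
    group
  refine ⟨z, v₂ * v₁ ^ (-f), .of_orderOf_eq_three hz hc hy3 (f5 _) fun g => ?_⟩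
  obtain ⟨p, w, hw, e⟩ := f4 g
  obtain ⟨w', hw', e'⟩ := f1' g (-f)
  have hconj : g * (v₂ * v₁ ^ (-f)) * g⁻¹ = v₂ * v₁ ^ (-f) * (v₁ ^ p * (w * w')) := by
    have : g * (v₂ * v₁ ^ (-f)) * g⁻¹ = (g * v₂ * g⁻¹) * (g * v₁ ^ (-f) * g⁻¹) := by group
    rw [this, e, e', mul_assoc (v₂ * v₁ ^ p), ← mul_assoc w, (hZc w hw _).eq]
    have h2 : v₁ ^ p * v₁ ^ (-f) = v₁ ^ (-f) * v₁ ^ p :=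
      ((Commute.refl v₁).zpow_right _).pow_left _ |>.eq
    calc v₂ * v₁ ^ p * (v₁ ^ (-f) * w * w') = v₂ * (v₁ ^ p * v₁ ^ (-f)) * (w * w') := by
          simp only [mul_assoc]
      _ = _ := by rw [h2]; simp only [mul_assoc]
  refine ⟨_, ?_, hconj⟩
  refine mul_mem ?_ (mul_mem hw hw')
  -- The cube of the conjugate is trivial, which forces `p` to be a multiple of `3`.
  have hp : (v₁ ^ 3) ^ p = 1 := by
    obtain ⟨w₃, hw₃, e₃⟩ := f1' (v₂ * v₁ ^ (-f))⁻¹ p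
    have h4 : (g * (v₂ * v₁ ^ (-f)) * g⁻¹) ^ 3 = 1 := by rw [conj_pow, hy3]; group
    rw [hconj, mul_pow_three_of_commutator (v := w₃) _ (hZc _ hw₃ _) (hZc _ hw₃ _) (hZ3 _ hw₃), hy3,
      one_mul, (hZc _ (mul_mem hw hw') _).symm.mul_pow, hZ3 _ (mul_mem hw hw'), mul_one, ← pow_mul,
      mul_comm, pow_mul] at h4
    · exact h4
    · rw [zpow_natCast] at e₃
      have h5 : v₁ ^ p * (v₂ * v₁ ^ (-f)) = v₂ * v₁ ^ (-f) * (v₁ ^ p * w₃) := by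
        rw [← e₃]; group
      rw [mul_assoc, (hZc _ (mul_mem hw hw') _).eq, ← mul_assoc, h5]
      rw [mul_assoc, mul_assoc, mul_assoc, mul_assoc, (hZc _ hw₃ _).eq]
      simp only [mul_assoc]
  have h6 : orderOf (v₁ ^ 3) = 3 := orderOf_eq_prime (hZ3 _ f2) h1
  obtain ⟨r, rfl⟩ := h6 ▸ orderOf_dvd_of_pow_eq_one hp
  rw [pow_mul]
  exact pow_mem f2 r

/-- A noncyclic finite `3`-group contains a normal subgroup of type `C_3 × C_3`. -/
theorem exists_admissiblePair (G : Type u) [Group G] [Finite G] (hG : IsPGroup 3 G)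
    (hnc : ¬ IsCyclic G) : ∃ z y : G, AdmissiblePair 0 z y := by
  induction hn : Nat.card G using Nat.strong_induction_on generalizing G with
  | _ n ih =>
    have hnt : Nontrivial G := by
      by_contra h
      have := not_nontrivial_iff_subsingleton.1 h
      exact hnc inferInstance
    obtain ⟨z, hz, hc⟩ := exists_central_orderOf_eq_three hG
    have hN := normal_zpowers_of_commute hc
    by_cases hQ : IsCyclic (G ⧸ Subgroup.zpowers z)
    · exact exists_admissiblePair_of_isCyclic_quotient hG hnc hz hc
    · have hlt : Nat.card (G ⧸ Subgroup.zpowers z) < n := by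
        rw [← hn, Subgroup.card_eq_card_quotient_mul_card_subgroup (Subgroup.zpowers z),
          Nat.card_zpowers, hz]
        have : 0 < Nat.card (G ⧸ Subgroup.zpowers z) := Nat.card_pos
        omega
      obtain ⟨v₁, v₂, h⟩ := ih _ hlt _ (hG.to_quotient _) hQ rfl
      exact h.exists_of_quotient hz hc

/-! ### The noncyclic groups of order `27` -/

/-- The product of `z ^ i * y ^ j * t ^ k` and `z ^ i' * y ^ j' * t ^ k'` in a group in which `z` is
central, `z ^ 3 = y ^ 3 = 1`, `t * y * t⁻¹ = y * z ^ δ` and `t ^ 3 = z ^ ε`. The element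
`z ^ i * y ^ j * t ^ k` is encoded by `9 * i + 3 * j + k`. -/
def codeMul (δ ε : ℕ) (a b : Fin 27) : Fin 27 :=
  ⟨9 * ((a / 9 + b / 9 + δ * (a % 3 * (b / 3 % 3)) + ε * ((a % 3 + b % 3) / 3)) % 3) +
    3 * ((a / 3 % 3 + b / 3 % 3) % 3) + (a % 3 + b % 3) % 3, by omega⟩

/-- The code of the inverse, for `ε ≤ 1`. -/
def codeInv (δ ε : ℕ) (a : Fin 27) : Fin 27 :=
  ⟨9 * ((3 - a / 9 + δ * (a % 3 * (a / 3 % 3)) + 2 * ε * ((a % 3 + 2) / 3)) % 3) +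
    3 * ((3 - a / 3 % 3) % 3) + (3 - a % 3) % 3, by omega⟩

/-- The conditions of a colouring bijection, for a map on codes. -/
def IsCodeColouring (δ ε : ℕ) (σ : Fin 27 → Fin 27) : Prop :=
  (∀ a, codeMul δ ε (codeInv δ ε a) a = 0) ∧ (∀ a b, σ a = σ b → a = b) ∧
    (∀ a b, codeMul δ ε (σ a) a = codeMul δ ε (σ b) b → a = b) ∧
    (∀ a b, codeMul δ ε (codeInv δ ε a) (σ a) = codeMul δ ε (codeInv δ ε b) (σ b) → a = b) ∧
    ∀ a b, codeMul δ ε (codeMul δ ε (codeInv δ ε a) (σ a)) a =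
      codeMul δ ε (codeMul δ ε (codeInv δ ε b) (σ b)) b → a = b

instance (δ ε : ℕ) (σ : Fin 27 → Fin 27) : Decidable (IsCodeColouring δ ε σ) := by
  unfold IsCodeColouring; infer_instance

/-- A colouring bijection of the elementary abelian group of order `27`. -/
theorem exists_isCodeColouring_zero_zero : ∃ σ, IsCodeColouring 0 0 σ :=
  ⟨![3, 7, 15, 18, 23, 24, 5, 11, 14, 19, 1, 4, 20, 21, 12, 13, 16, 2, 22, 17, 10, 6,
    9, 25, 26, 0, 8], by decide +kernel⟩

/-- A colouring bijection of the group of order `27` and exponent `3` that is not commutative. -/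
theorem exists_isCodeColouring_one_zero : ∃ σ, IsCodeColouring 1 0 σ :=
  ⟨![21, 7, 8, 13, 16, 11, 23, 14, 17, 4, 1, 3, 20, 2, 25, 18, 0, 9, 19, 26, 10, 5, 6,
    22, 24, 12, 15], by decide +kernel⟩

/-- A colouring bijection of the group of order `27` and exponent `9` that is not commutative. -/
theorem exists_isCodeColouring_one_one : ∃ σ, IsCodeColouring 1 1 σ :=
  ⟨![3, 25, 26, 8, 21, 4, 13, 19, 12, 6, 23, 20, 10, 15, 5, 14, 2, 24, 18, 22, 1, 11,
    0, 16, 7, 17, 9], by decide +kernel⟩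

/-- The map `(i, j, k) ↦ z ^ i * y ^ j * t ^ k` transports a colouring of codes to the group. -/
theorem isColourableGroup_of_isCodeColouring {G : Type*} [Group G] [Finite G] {z y t : G}
    {δ ε : ℕ} (hz3 : z ^ 3 = 1) (hc : ∀ g, Commute g z) (hy3 : y ^ 3 = 1) (hcard : Nat.card G = 27)
    (hgen : ∀ g : G, ∃ i j k : ℕ, g = z ^ i * y ^ j * t ^ k) (hδ : t * y = z ^ δ * y * t)
    (hε : t ^ 3 = z ^ ε) (h : ∃ σ, IsCodeColouring δ ε σ) : IsColourableGroup G := by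
  obtain ⟨σ, h0, h1, h2, h3, h4⟩ := h
  have hz : ∀ (i : ℕ) (g : G), g * z ^ i = z ^ i * g := fun i g => ((hc g).pow_right i).eq
  have hty : ∀ k j : ℕ, t ^ k * y ^ j = z ^ (δ * (k * j)) * (y ^ j * t ^ k) := by
    have h1 : ∀ j : ℕ, t * y ^ j = z ^ (δ * j) * (y ^ j * t) := by
      intro j
      induction j with
      | zero => simp
      | succ j ih =>
        rw [pow_succ, ← mul_assoc, ih, mul_assoc, mul_assoc, hδ, mul_assoc (z ^ δ),
          ← mul_assoc (y ^ j), hz, mul_assoc, ← mul_assoc, ← pow_add, mul_add, mul_one, mul_assoc]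
    intro k j
    induction k with
    | zero => simp
    | succ k ih =>
      rw [pow_succ, mul_assoc, h1, ← mul_assoc (t ^ k), hz, mul_assoc, ← mul_assoc (t ^ k), ih,
        mul_assoc, ← mul_assoc, ← pow_add, mul_assoc, add_mul, one_mul, mul_add, add_comm]
  let E : ℕ → ℕ → ℕ → G := fun i j k => z ^ i * (y ^ j * t ^ k)
  have hE : ∀ i j k, E i j k = E ((i + ε * (k / 3)) % 3) (j % 3) (k % 3) := by
    intro i j k
    simp only [E]
    rw [← pow_eq_pow_mod _ hz3, ← pow_eq_pow_mod _ hy3, pow_add, mul_assoc]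
    congr 1
    rw [pow_mul, ← hε, ← pow_mul]
    nth_rw 1 [← Nat.div_add_mod k 3]
    rw [pow_add, ← mul_assoc, ← mul_assoc, pow_mul, hε, ← pow_mul, hz]
  have hEmul : ∀ i j k i' j' k', E i j k * E i' j' k' =
      E (i + i' + δ * (k * j')) (j + j') (k + k') := by
    intro i j k i' j' k'
    simp only [E]
    calc z ^ i * (y ^ j * t ^ k) * (z ^ i' * (y ^ j' * t ^ k'))
        = z ^ i * ((y ^ j * t ^ k) * z ^ i') * (y ^ j' * t ^ k') := by simp only [mul_assoc]
      _ = z ^ i * z ^ i' * y ^ j * (t ^ k * y ^ j') * t ^ k' := by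
          rw [hz i']; simp only [mul_assoc]
      _ = z ^ i * z ^ i' * (y ^ j * z ^ (δ * (k * j'))) * (y ^ j' * t ^ k) * t ^ k' := by
          rw [hty]; simp only [mul_assoc]
      _ = _ := by
          rw [hz _ (y ^ j), pow_add z, pow_add z, pow_add y, pow_add t]; simp only [mul_assoc]
  let e : Fin 27 → G := fun a => E (a / 9) (a / 3 % 3) (a % 3)
  have hmul : ∀ a b, e (codeMul δ ε a b) = e a * e b := by
    intro a b
    simp only [e, hEmul]
    rw [hE (_ + _ + _)]
    congr 1 <;> simp only [codeMul] <;> omega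
  have hsurj : Function.Surjective e := by
    intro g
    obtain ⟨i, j, k, rfl⟩ := hgen g
    refine ⟨⟨9 * ((i + ε * (k / 3)) % 3) + 3 * (j % 3) + k % 3, by omega⟩, ?_⟩
    rw [mul_assoc]
    change _ = E i j k
    rw [hE i]
    simp only [e]
    congr 1 <;> omega
  have hbij : Function.Bijective e := by
    refine hsurj.bijective_of_nat_card_le ?_
    rw [hcard, Nat.card_eq_fintype_card, Fintype.card_fin]
  have he0 : e 0 = 1 := by simp [e, E]
  have hinv : ∀ a, e (codeInv δ ε a) = (e a)⁻¹ := fun a => by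
    rw [eq_inv_iff_mul_eq_one, ← hmul, h0, he0]
  let e' := Equiv.ofBijective e hbij
  have key : ∀ f : Fin 27 → Fin 27, (∀ a b, f a = f b → a = b) →
      Function.Injective fun x => e (f (e'.symm x)) := fun f hf a b hab =>
    e'.symm.injective (hf _ _ (hbij.1 hab))
  have hx : ∀ x, e (e'.symm x) = x := e'.apply_symm_apply
  refine isColourableGroup_of_injective (fun x => e (σ (e'.symm x))) (key _ h1) ?_ ?_ ?_
  · have := key _ h2
    simpa only [hmul, hx] using this
  · have := key _ h3
    simpa only [hmul, hinv, hx] using this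
  · have := key _ h4
    simpa only [hmul, hinv, hx] using this

/-! ### The groups `L_r` -/

/-- Generators `a`, `b` of a group that satisfy the relations of `L_r`. -/
structure IsModularPair {G : Type*} [Group G] (r : ℕ) (a b : G) : Prop where
  closure_eq_top : Subgroup.closure {a, b} = ⊤
  pow_left : a ^ 3 ^ (r - 1) = 1
  pow_right : b ^ 3 = 1
  conj : b * a * b⁻¹ = a ^ (1 + 3 ^ (r - 2))

namespace IsModularPair

variable {G : Type*} [Group G] {r : ℕ} {a b : G}

theorem pow_mul_pow (h : IsModularPair r a b) (i j : ℕ) :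
    b ^ j * a ^ i = a ^ (i * (1 + 3 ^ (r - 2)) ^ j) * b ^ j := by
  have h1 : ∀ i : ℕ, b * a ^ i = a ^ ((1 + 3 ^ (r - 2)) * i) * b := fun i => by
    rw [pow_mul, ← h.conj, conj_pow]; group
  induction j with
  | zero => simp
  | succ j ih =>
    rw [pow_succ', mul_assoc, ih, ← mul_assoc, h1, mul_assoc, pow_succ (1 + 3 ^ (r - 2))]
    congr 2
    ring

theorem exists_eq_pow_mul_pow (h : IsModularPair r a b) (g : G) :
    ∃ i j : ℕ, i < 3 ^ (r - 1) ∧ j < 3 ∧ g = a ^ i * b ^ j := by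
  suffices ∃ i j : ℕ, g = a ^ i * b ^ j by
    obtain ⟨i, j, rfl⟩ := this
    refine ⟨i % 3 ^ (r - 1), j % 3, Nat.mod_lt _ (by positivity), Nat.mod_lt _ (by norm_num), ?_⟩
    rw [← pow_eq_pow_mod i h.pow_left, ← pow_eq_pow_mod j h.pow_right]
  have hg : g ∈ Subgroup.closure {a, b} := by rw [h.closure_eq_top]; trivial
  have hmul : ∀ i j i' j' : ℕ, ∃ m n : ℕ, a ^ i * b ^ j * (a ^ i' * b ^ j') = a ^ m * b ^ n := by
    intro i j i' j'
    refine ⟨i + i' * (1 + 3 ^ (r - 2)) ^ j, j + j', ?_⟩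
    rw [mul_assoc, ← mul_assoc (b ^ j), h.pow_mul_pow, pow_add, pow_add]
    simp only [mul_assoc]
  induction hg using Subgroup.closure_induction with
  | mem x hx =>
    rcases hx with rfl | rfl
    · exact ⟨1, 0, by simp⟩
    · exact ⟨0, 1, by simp⟩
  | one => exact ⟨0, 0, by simp⟩
  | mul x y _ _ hx hy =>
    obtain ⟨i, j, rfl⟩ := hx
    obtain ⟨i', j', rfl⟩ := hy
    exact hmul i j i' j'
  | inv x _ hx =>
    obtain ⟨i, j, rfl⟩ := hx
    have ha : (a ^ i)⁻¹ = a ^ ((3 ^ (r - 1) - 1) * i) := by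
      rw [inv_eq_iff_mul_eq_one, ← pow_add, add_comm, ← Nat.succ_mul, Nat.succ_eq_add_one,
        Nat.sub_add_cancel (Nat.one_le_pow _ _ (by norm_num)), pow_mul, h.pow_left, one_pow]
    have hb : (b ^ j)⁻¹ = b ^ (2 * j) := by
      rw [inv_eq_iff_mul_eq_one, ← pow_add, add_comm, ← Nat.succ_mul, pow_mul, h.pow_right, one_pow]
    obtain ⟨m, n, e⟩ := hmul 0 (2 * j) ((3 ^ (r - 1) - 1) * i) 0
    refine ⟨m, n, ?_⟩
    rw [mul_inv_rev, ha, hb, ← e]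
    simp

theorem card_le (h : IsModularPair r a b) (hr : 1 ≤ r) : Finite G ∧ Nat.card G ≤ 3 ^ r := by
  let f : Fin (3 ^ (r - 1)) × Fin 3 → G := fun u => a ^ (u.1 : ℕ) * b ^ (u.2 : ℕ)
  have hf : Function.Surjective f := fun g => by
    obtain ⟨i, j, hi, hj, rfl⟩ := h.exists_eq_pow_mul_pow g
    exact ⟨(⟨i, hi⟩, ⟨j, hj⟩), rfl⟩
  refine ⟨Finite.of_surjective f hf, ?_⟩
  have := Nat.card_le_card_of_surjective f hf
  rwa [Nat.card_prod, Nat.card_fin, Nat.card_fin, ← pow_succ, Nat.sub_add_cancel hr] at this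

theorem groupL (r : ℕ) : IsModularPair r (PresentedGroup.of 0 : GroupL r) (PresentedGroup.of 1) := by
  refine ⟨?_, ?_, ?_, ?_⟩
  · rw [← PresentedGroup.closure_range_of]
    congr 1
    ext x
    simp [Fin.exists_fin_two, eq_comm]
  · exact PresentedGroup.one_of_mem (Or.inl rfl)
  · exact PresentedGroup.one_of_mem (Or.inr (Or.inl rfl))
  · exact PresentedGroup.mk_eq_mk_of_mul_inv_mem (Or.inr (Or.inr rfl))

/-- As `L_r` has at most `3 ^ r` elements, it is determined by its relations and its order. -/
theorem nonempty_mulEquiv [Finite G] (h : IsModularPair r a b) (hr : 1 ≤ r)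
    (hcard : Nat.card G = 3 ^ r) : Nonempty (G ≃* GroupL r) := by
  have hrel : ∀ x ∈ relatorsL r, FreeGroup.lift ![a, b] x = 1 := by
    rintro x (rfl | rfl | rfl)
    · simpa using h.pow_left
    · simpa using h.pow_right
    · simp [← h.conj]
  let F : GroupL r →* G := PresentedGroup.toGroup hrel
  have hF : Function.Surjective F := by
    rw [← MonoidHom.range_eq_top, eq_top_iff, ← h.closure_eq_top, Subgroup.closure_le]
    rintro x (rfl | rfl)
    · exact ⟨PresentedGroup.of 0, PresentedGroup.toGroup.of hrel⟩
    · exact ⟨PresentedGroup.of 1, PresentedGroup.toGroup.of hrel⟩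
  obtain ⟨hfin, hle⟩ := (groupL r).card_le hr
  exact ⟨(MulEquiv.ofBijective F (hF.bijective_of_nat_card_le (by rwa [hcard]))).symm⟩

theorem exists_isCoatom_isCyclic [Finite G] [Nontrivial G] (h : IsModularPair r a b) :
    ∃ M : Subgroup G, IsCoatom M ∧ IsCyclic M := by
  by_cases ha : Subgroup.zpowers a = ⊤
  · have hcyc : IsCyclic G := ⟨a, fun x => (Subgroup.eq_top_iff' _).1 ha x⟩
    obtain ⟨M, hM, -⟩ := (eq_top_or_exists_le_coatom (⊥ : Subgroup G)).resolve_left bot_ne_top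
    exact ⟨M, hM, inferInstance⟩
  · refine ⟨Subgroup.zpowers a, ⟨ha, fun K hK => ?_⟩, inferInstance⟩
    obtain ⟨g, hgK, hg⟩ := SetLike.exists_of_lt hK
    have haK : a ∈ K := hK.le (Subgroup.mem_zpowers a)
    obtain ⟨i, j, -, -, rfl⟩ := h.exists_eq_pow_mul_pow g
    have hbj : b ^ j ∈ K := by
      have := mul_mem (inv_mem (pow_mem haK i)) hgK
      rwa [inv_mul_cancel_left] at this
    have hb1 : b ^ j ≠ 1 := fun e => hg (by
      rw [e, mul_one]; exact pow_mem (Subgroup.mem_zpowers a) i)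
    have hbK : b ∈ K := Subgroup.zpowers_le.2 hbj
      (mem_zpowers_of_mem_zpowers_of_ne_one h.pow_right (pow_mem (Subgroup.mem_zpowers b) j) hb1)
    rw [eq_top_iff, ← h.closure_eq_top, Subgroup.closure_le]
    rintro x (rfl | rfl)
    exacts [haK, hbK]

end IsModularPair

/-- A finite group of order `3 ^ r`, `r ≥ 4`, that is generated by two noncommuting elements
satisfying the relations of `L_r`; such a group is isomorphic to `L_r`. -/
def IsModularGroup (G : Type*) [Group G] : Prop :=
  ∃ r : ℕ, 4 ≤ r ∧ Nat.card G = 3 ^ r ∧ ∃ a b : G, IsModularPair r a b ∧ a ^ 3 ^ (r - 2) ≠ 1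

theorem IsModularGroup.exists_not_commute {G : Type*} [Group G] (h : IsModularGroup G) :
    ∃ a b : G, ¬ Commute a b := by
  obtain ⟨r, -, -, a, b, h, h1⟩ := h
  refine ⟨a, b, fun hab => h1 ?_⟩
  have := h.conj
  rwa [← hab.eq, mul_inv_cancel_right, pow_add, pow_one, left_eq_mul] at this

/-! ### The induction -/

/-- The subgroups of a cyclic `3`-group form a chain. -/
theorem mem_zpowers_or_mem_zpowers_of_isCyclic {G : Type*} [Group G] [Finite G] [IsCyclic G]
    (hG : IsPGroup 3 G) (a b : G) :
    a ∈ Subgroup.zpowers b ∨ b ∈ Subgroup.zpowers a := by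
  have : Fact (Nat.Prime 3) := ⟨by norm_num⟩
  obtain ⟨g, hg⟩ := IsCyclic.exists_generator (α := G)
  obtain ⟨i, rfl⟩ := mem_zpowers_iff_exists_natPow.1 (hg a)
  obtain ⟨j, rfl⟩ := mem_zpowers_iff_exists_natPow.1 (hg b)
  rcases Nat.eq_zero_or_pos i with rfl | hi
  · left; simp
  rcases Nat.eq_zero_or_pos j with rfl | hj
  · right; simp
  have key : ∀ α u v : ℕ, ¬ 3 ∣ u → g ^ (3 ^ α * v) ∈ Subgroup.zpowers (g ^ (3 ^ α * u)) := by
    intro α u v hu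
    rw [pow_mul, pow_mul]
    refine pow_mem (mem_zpowers_pow_iff.2 ?_) v
    obtain ⟨n, hn⟩ := IsPGroup.iff_orderOf.1 hG (g ^ 3 ^ α)
    rw [hn]
    exact Nat.Coprime.pow_left n ((Nat.Prime.coprime_iff_not_dvd (by norm_num)).2 hu) |>.symm
  obtain ⟨α, u, hu, rfl⟩ := Nat.exists_eq_pow_mul_and_not_dvd hi.ne' 3 (by norm_num)
  obtain ⟨β, v, hv, rfl⟩ := Nat.exists_eq_pow_mul_and_not_dvd hj.ne' 3 (by norm_num)
  rcases le_total α β with h | h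
  · right
    rw [← Nat.add_sub_cancel' h, pow_add, mul_assoc]
    exact key _ _ _ hu
  · left
    rw [← Nat.add_sub_cancel' h, pow_add, mul_assoc]
    exact key _ _ _ hv

namespace AdmissiblePair

section

variable {G : Type*} [Group G] {k : ℕ} {c y : G}

theorem zero_left_pow_three (h : AdmissiblePair 0 c y) : c ^ 3 = 1 := by
  have := pow_orderOf_eq_one c
  rwa [h.orderOf_left, zero_add, pow_one] at this

/-- Elements of the subgroup generated by an admissible pair are central modulo the group of order
`3` generated by a power of `c`. -/
theorem exists_conj_eq (h : AdmissiblePair k c y) {x : G} (hx : x ∈ h.subgroup) (g : G) :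
    ∃ v ∈ Subgroup.zpowers (c ^ 3 ^ k), g * x * g⁻¹ = x * v := by
  obtain ⟨i, j, rfl⟩ := h.mem_subgroup.1 hx
  obtain ⟨p, hp⟩ := h.conj g
  refine ⟨(c ^ (3 ^ k * p)) ^ j, ?_, ?_⟩
  · rw [pow_mul]
    exact pow_mem (pow_mem (Subgroup.mem_zpowers _) _) _
  · have h1 : g * (c ^ i * y ^ j) * g⁻¹ = c ^ i * (g * y * g⁻¹) ^ j := by
      rw [conj_pow, ← mul_assoc, ((h.commute g).pow_right i).eq]
      simp only [mul_assoc]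
    rw [h1, hp, ((h.commute y).pow_right _).mul_pow, mul_assoc]

theorem commute_of_mem_zpowers (h : AdmissiblePair k c y) {v : G}
    (hv : v ∈ Subgroup.zpowers (c ^ 3 ^ k)) (g : G) : Commute v g := by
  obtain ⟨i, rfl⟩ := hv
  exact (((h.commute g).pow_right _).zpow_right i).symm

theorem pow_three_of_mem_zpowers (h : AdmissiblePair k c y) {v : G}
    (hv : v ∈ Subgroup.zpowers (c ^ 3 ^ k)) : v ^ 3 = 1 := by
  refine pow_three_eq_one_of_mem_zpowers ?_ hv
  rw [← pow_mul, ← pow_succ, ← h.orderOf_left, pow_orderOf_eq_one]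

theorem pow_three_of_mem (h : AdmissiblePair 0 c y) {x : G} (hx : x ∈ h.subgroup) : x ^ 3 = 1 := by
  obtain ⟨i, j, rfl⟩ := h.mem_subgroup.1 hx
  rw [(((h.commute (y ^ j)).symm).pow_left i).mul_pow, ← pow_mul, ← pow_mul, mul_comm i,
    mul_comm j, pow_mul, pow_mul, h.zero_left_pow_three, h.pow_three, one_pow, one_pow, one_mul]

/-- Multiplication by an element of the elementary abelian normal subgroup does not change the cube,
as commutators are central of order `3`. -/
theorem mul_pow_three (h : AdmissiblePair 0 c y) {x : G} (hx : x ∈ h.subgroup) (a : G) :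
    (a * x) ^ 3 = a ^ 3 := by
  obtain ⟨v, hv, e⟩ := h.exists_conj_eq hx a⁻¹
  have hc := h.commute_of_mem_zpowers hv
  rw [mul_pow_three_of_commutator (v := v) _ (hc _) (hc _) (h.pow_three_of_mem_zpowers hv),
    h.pow_three_of_mem hx, mul_one]
  rw [mul_assoc, ← e]
  group

/-- If the quotient by the subgroup generated by an admissible pair is cyclic, then all commutators
lie in the group of order `3` generated by a power of `c`. -/
theorem exists_mul_eq_of_isCyclic (h : AdmissiblePair k c y) [IsCyclic (G ⧸ h.subgroup)] (a b : G) :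
    ∃ v ∈ Subgroup.zpowers (c ^ 3 ^ k), a * b = b * a * v := by
  have := normal_zpowers_of_commute (z := c ^ 3 ^ k) fun g => (h.commute g).pow_right _
  refine exists_mul_eq_of_isCyclic_quotient (H := h.subgroup) (fun x hx g => ?_) a b
  obtain ⟨v, hv, e⟩ := h.exists_conj_eq hx g
  refine ⟨v, hv, ?_⟩
  rw [mul_assoc, (h.commute_of_mem_zpowers hv g).symm.eq, ← mul_assoc, ← e]
  group

/-- A complement of a subgroup of order `3` in an elementary abelian normal subgroup, together with
which it still is normalized with central commutators. -/
theorem exists_complement [Finite G] (h : AdmissiblePair 0 c y) {w : G} (hw : w ∈ h.subgroup)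
    (hw1 : w ≠ 1) :
    ∃ y' ∈ h.subgroup, y' ∉ Subgroup.zpowers w ∧
      (∀ g, ∃ v ∈ Subgroup.zpowers w, g * y' * g⁻¹ = y' * v) ∧
      ∀ K : Subgroup G, w ∈ K → y' ∈ K → h.subgroup ≤ K := by
  by_cases hc : c ∈ Subgroup.zpowers w
  · have hwc : Subgroup.zpowers w ≤ Subgroup.zpowers c := by
      refine Subgroup.zpowers_le.2 (mem_zpowers_of_mem_zpowers_of_ne_one (h.pow_three_of_mem hw) hc ?_)
      rintro rfl
      simpa using h.orderOf_left
    refine ⟨y, h.right_mem, fun hy => h.notMem (hwc hy), fun g => ?_, fun K hwK hyK x hx => ?_⟩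
    · obtain ⟨v, hv, e⟩ := h.exists_conj_eq h.right_mem g
      exact ⟨v, Subgroup.zpowers_le.2 hc (by simpa using hv), e⟩
    · obtain ⟨i, j, rfl⟩ := h.mem_subgroup.1 hx
      exact mul_mem (pow_mem (Subgroup.zpowers_le.2 hwK hc) _) (pow_mem hyK _)
  · refine ⟨c, h.left_mem, hc, fun g => ⟨1, one_mem _, by rw [(h.commute g).eq]; group⟩,
      fun K hwK hcK x hx => ?_⟩
    have hyK : y ∈ K := by
      obtain ⟨i, j, rfl⟩ := h.mem_subgroup.1 hw
      have h1 : y ^ j ∈ K := by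
        have := mul_mem (inv_mem (pow_mem hcK i)) hwK
        rwa [inv_mul_cancel_left] at this
      refine Subgroup.zpowers_le.2 h1 (mem_zpowers_of_mem_zpowers_of_ne_one h.pow_three
        (pow_mem (Subgroup.mem_zpowers y) j) fun h2 => hc ?_)
      rw [h2, mul_one] at hw1 ⊢
      exact mem_zpowers_of_mem_zpowers_of_ne_one h.zero_left_pow_three
        (pow_mem (Subgroup.mem_zpowers c) i) hw1
    obtain ⟨i, j, rfl⟩ := h.mem_subgroup.1 hx
    exact mul_mem (pow_mem hcK _) (pow_mem hyK _)

end

/-- The induction step for an admissible pair with commutative noncyclic quotient. -/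
theorem isColourableGroup_of_commute {G : Type u} [Group G] [Finite G] (hG : IsPGroup 3 G)
    (ih : ∀ (H : Type u) [Group H] [Finite H], Nat.card H < Nat.card G → IsPGroup 3 H →
      ¬ IsCyclic H → ¬ IsModularGroup H → IsColourableGroup H)
    {k : ℕ} {c y : G} (h : AdmissiblePair k c y) (hcomm : ∀ a b : G ⧸ h.subgroup, Commute a b)
    (hnc : ¬ IsCyclic (G ⧸ h.subgroup)) : IsColourableGroup G := by
  refine h.isColourableGroup (ih _ ?_ (hG.to_quotient _) hnc fun hm => ?_)
  · rw [Subgroup.card_eq_card_quotient_mul_card_subgroup h.subgroup, h.card_subgroup]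
    have h1 : 0 < Nat.card (G ⧸ h.subgroup) := Nat.card_pos
    have h2 : 1 < 3 ^ (k + 2) := Nat.one_lt_pow (by omega) (by norm_num)
    exact lt_mul_of_one_lt_right h1 h2
  · obtain ⟨a, b, hab⟩ := hm.exists_not_commute
    exact hab (hcomm a b)

end AdmissiblePair

/-- A quotient is commutative if the group is generated by two elements that commute in the quotient
and a set of elements that are central in the quotient. -/
theorem commute_quotient_of_generators {G : Type*} [Group G] {N K : Subgroup G} [K.Normal] {a b : G}
    (hgen : ∀ g, ∃ i j : ℕ, ∃ n ∈ N, g = a ^ i * b ^ j * n) (hab : b * a * b⁻¹ * a⁻¹ ∈ K)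
    (hN : ∀ n ∈ N, ∀ g, ∃ v ∈ K, g * n * g⁻¹ = n * v) (x x' : G ⧸ K) : Commute x x' := by
  have h1 : Commute (QuotientGroup.mk' K a) (QuotientGroup.mk' K b) := by
    have h : QuotientGroup.mk' K (b * a * b⁻¹ * a⁻¹) = 1 := (QuotientGroup.eq_one_iff _).2 hab
    simp only [map_mul, map_inv] at h
    rw [mul_inv_eq_one, mul_inv_eq_iff_eq_mul] at h
    exact h.symm
  have h2 : ∀ n ∈ N, ∀ g, Commute g (QuotientGroup.mk' K n) := by
    intro n hn g
    obtain ⟨g, rfl⟩ := QuotientGroup.mk'_surjective K g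
    obtain ⟨v, hv, e⟩ := hN n hn g
    have hv1 : QuotientGroup.mk' K v = 1 := (QuotientGroup.eq_one_iff _).2 hv
    have := congrArg (QuotientGroup.mk' K) e
    simp only [map_mul, map_inv, hv1, mul_one] at this
    exact mul_inv_eq_iff_eq_mul.1 this
  obtain ⟨x, rfl⟩ := QuotientGroup.mk'_surjective K x
  obtain ⟨x', rfl⟩ := QuotientGroup.mk'_surjective K x'
  obtain ⟨i, j, n, hn, rfl⟩ := hgen x
  obtain ⟨i', j', n', hn', rfl⟩ := hgen x'
  simp only [map_mul, map_pow]
  refine Commute.mul_left (Commute.mul_right ?_ (h2 _ hn' _)) (h2 _ hn _).symm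
  refine Commute.mul_left ?_ ?_
  · exact Commute.mul_right ((Commute.refl _).pow_pow _ _) (h1.pow_pow _ _)
  · exact Commute.mul_right (h1.symm.pow_pow _ _) ((Commute.refl _).pow_pow _ _)

namespace AdmissiblePair

variable {G : Type u} [Group G] [Finite G] {z y : G}

/-- If `G ⧸ N ≅ L_r` with generators the images of `a` and `b`, then `c = a ^ 3 ^ (r - 2)` is
central, since already `a ^ 9` is, and the commutator `k` of `a` and `b` lies in `c N`. When
`c ^ 3 = 1`, the quotient by the normal subgroup `⟨z, k⟩` of type `C_3 × C_3` is commutative and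
noncyclic. Otherwise `c` has order `9`, the quotient by the normal subgroup `⟨c⟩ N` of type
`C_9 × C_3` is commutative and noncyclic. -/
theorem isColourableGroup_of_isModularGroup (hG : IsPGroup 3 G)
    (ih : ∀ (H : Type u) [Group H] [Finite H], Nat.card H < Nat.card G → IsPGroup 3 H →
      ¬ IsCyclic H → ¬ IsModularGroup H → IsColourableGroup H)
    (h : AdmissiblePair 0 z y) (hQ : IsModularGroup (G ⧸ h.subgroup)) : IsColourableGroup G := by
  obtain ⟨r, hr, -, a, b, hab, ha1⟩ := hQ
  obtain ⟨s, rfl⟩ : ∃ s, r = s + 4 := ⟨r - 4, by omega⟩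
  obtain ⟨a, rfl⟩ := QuotientGroup.mk'_surjective _ a
  obtain ⟨b, rfl⟩ := QuotientGroup.mk'_surjective _ b
  set N := h.subgroup with hN
  have hgen : ∀ g, ∃ i j : ℕ, ∃ n ∈ N, g = a ^ i * b ^ j * n := fun g => by
    obtain ⟨i, j, -, -, e⟩ := hab.exists_eq_pow_mul_pow (g : G ⧸ N)
    refine ⟨i, j, (a ^ i * b ^ j)⁻¹ * g, QuotientGroup.eq.1 e.symm, by group⟩
  let c := a ^ 3 ^ (s + 2)
  have hcN : c ∉ N := fun hc => ha1 ((QuotientGroup.eq_one_iff _).2 hc)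
  have hw : c ^ 3 ∈ N := by
    have h1 : a ^ 3 ^ (s + 3) ∈ N := (QuotientGroup.eq_one_iff _).1 hab.pow_left
    rwa [pow_succ 3, pow_mul] at h1
  obtain ⟨n, hn, hbn⟩ : ∃ n ∈ N, b * a * b⁻¹ = a * c * n := by
    have h1 : QuotientGroup.mk' N b * QuotientGroup.mk' N a * (QuotientGroup.mk' N b)⁻¹ =
      QuotientGroup.mk' N a ^ (1 + 3 ^ (s + 2)) := hab.conj
    refine ⟨(a * c)⁻¹ * (b * a * b⁻¹), QuotientGroup.eq.1 ?_, by group⟩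
    change QuotientGroup.mk' N _ = QuotientGroup.mk' N _
    simp only [c, map_mul, map_inv, map_pow] at h1 ⊢
    rw [h1, pow_add _ 1, pow_one]
  have hac : Commute a c := (Commute.refl a).pow_right _
  have h3N : ∀ x ∈ N, x ^ 3 = 1 := fun x hx => h.pow_three_of_mem hx
  -- Conjugation by `b` fixes `a ^ 9`.
  have hb9 : Commute (a ^ 9) b := by
    have e1 : b * a ^ 3 * b⁻¹ = a ^ 3 * c ^ 3 := by
      rw [← conj_pow, hbn, h.mul_pow_three hn, hac.mul_pow]
    have e2 : b * a ^ 9 * b⁻¹ = a ^ 9 := by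
      rw [show 9 = 3 * 3 by rfl, pow_mul, ← conj_pow, e1, h.mul_pow_three hw]
    exact (mul_inv_eq_iff_eq_mul.1 e2).symm
  have hN3 : ∀ x ∈ N, Commute (a ^ 3) x := by
    intro x hx
    obtain ⟨v, hv, e⟩ := h.exists_conj_eq hx a
    have hvc := h.commute_of_mem_zpowers hv
    have hv3 := h.pow_three_of_mem_zpowers hv
    have e' : a * x = x * a * v := by
      rw [mul_assoc, ← (hvc a).eq, ← mul_assoc, ← e]; group
    have e2 : x⁻¹ * a * x⁻¹⁻¹ = a * v := by
      rw [inv_inv, mul_assoc, e']; group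
    have e3 : x⁻¹ * a ^ 3 * x⁻¹⁻¹ = a ^ 3 := by
      rw [← conj_pow, e2, (hvc a).symm.mul_pow, hv3, mul_one]
    rw [inv_inv, mul_assoc, inv_mul_eq_iff_eq_mul] at e3
    exact e3
  have hc : ∀ g, Commute g c := by
    have h9 : ∀ g, Commute g (a ^ 9) := fun g => by
      obtain ⟨i, j, x, hx, rfl⟩ := hgen g
      refine Commute.mul_left (Commute.mul_left (((Commute.refl a).pow_right _).pow_left _)
        (hb9.symm.pow_left _)) ?_
      rw [show 9 = 3 * 3 by rfl, pow_mul]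
      exact ((hN3 x hx).pow_left 3).symm
    intro g
    have : c = (a ^ 9) ^ 3 ^ s := by
      simp only [c]
      rw [← pow_mul, pow_add, mul_comm]
      norm_num
    rw [this]
    exact (h9 g).pow_right _
  set k := b * a * b⁻¹ * a⁻¹ with hk
  obtain ⟨n', hn', hkn⟩ : ∃ n' ∈ N, k = c * n' := by
    refine ⟨a * n * a⁻¹, h.normal_subgroup.conj_mem n hn a, ?_⟩
    rw [hk, hbn, hac.eq]
    group
  have hkN : k ∉ N := fun hkN => hcN (by
    rw [hkn] at hkN
    exact (Subgroup.mul_mem_cancel_right N hn').1 hkN)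
  have hkcomm : ∀ v, b * a = a * b * v → (∀ g, Commute v g) → k = v := by
    intro v e hv
    rw [hk, e, ← (hv (a * b)).eq]
    group
  by_cases hw1 : c ^ 3 = 1
  · have hp : AdmissiblePair 0 z k := by
      refine .of_orderOf_eq_three (by simpa using h.orderOf_left) h.commute ?_ (fun hkz => hkN ?_)
        fun g => ?_
      · rw [hkn, h.mul_pow_three hn', hw1]
      · exact Subgroup.zpowers_le.2 h.left_mem hkz
      · obtain ⟨v, hv, e⟩ := h.exists_conj_eq hn' g
        refine ⟨v, by simpa using hv, ?_⟩
        rw [hkn, ← mul_assoc, (hc g).eq, mul_assoc, mul_assoc, ← mul_assoc g, e, mul_assoc]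
    refine hp.isColourableGroup_of_commute hG ih ?_ fun hcyc => ?_
    · refine commute_quotient_of_generators hgen hp.right_mem fun x hx g => ?_
      obtain ⟨v, hv, e⟩ := h.exists_conj_eq hx g
      exact ⟨v, Subgroup.zpowers_le.2 hp.left_mem (by simpa using hv), e⟩
    · obtain ⟨v, hv, e⟩ := hp.exists_mul_eq_of_isCyclic b a
      refine hkN ?_
      rw [hkcomm v e (hp.commute_of_mem_zpowers hv)]
      exact Subgroup.zpowers_le.2 h.left_mem (by simpa using hv)
  · obtain ⟨y', hy', hyw, hconj, hle⟩ := h.exists_complement hw hw1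
    have hc9 : c ^ 9 = 1 := by
      rw [show 9 = 3 * 3 by rfl, pow_mul]; exact h3N _ hw
    have hp : AdmissiblePair 1 c y' := by
      have : Fact (Nat.Prime 3) := ⟨by norm_num⟩
      refine ⟨orderOf_eq_prime_pow (by simpa using hw1) hc9, hc, h3N _ hy', fun hy => ?_,
        fun g => ?_⟩
      · obtain ⟨e, rfl⟩ := mem_zpowers_iff_exists_natPow.1 hy
        rcases em (3 ∣ e) with ⟨f, rfl⟩ | he
        · rw [pow_mul] at hyw
          exact hyw (pow_mem (Subgroup.mem_zpowers _) _)
        · refine hcN (Subgroup.zpowers_le.2 hy' (mem_zpowers_pow_iff.2 ?_))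
          refine Nat.Coprime.coprime_dvd_right (orderOf_dvd_of_pow_eq_one hc9) ?_
          exact Nat.Coprime.pow_right 2 ((Nat.Prime.coprime_iff_not_dvd (by norm_num)).2 he).symm
      · obtain ⟨v, hv, e⟩ := hconj g
        obtain ⟨p, rfl⟩ := mem_zpowers_iff_exists_natPow.1 hv
        exact ⟨p, by rw [e, pow_mul, pow_one]⟩
    have hNle : N ≤ hp.subgroup := hle _ (pow_mem hp.left_mem 3) hp.right_mem
    refine hp.isColourableGroup_of_commute hG ih ?_ fun hcyc => ?_
    · refine commute_quotient_of_generators hgen ?_ fun x hx g => ?_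
      · rw [← hk, hkn]
        exact mul_mem hp.left_mem (hNle hn')
      · exact ⟨x⁻¹ * (g * x * g⁻¹), mul_mem (inv_mem (hNle hx))
          (hp.normal_subgroup.conj_mem x (hNle hx) g), by group⟩
    · obtain ⟨v, hv, e⟩ := hp.exists_mul_eq_of_isCyclic b a
      refine hkN ?_
      rw [hkcomm v e (hp.commute_of_mem_zpowers hv)]
      exact Subgroup.zpowers_le.2 hw (by simpa using hv)

end AdmissiblePair

namespace AdmissiblePair

variable {G : Type u} [Group G] {z y : G}

theorem pow_mul_of_mul_eq (h : AdmissiblePair 0 z y) {t : G} {δ : ℕ} (hδ : t * y = z ^ δ * y * t)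
    (j : ℕ) : t * y ^ j = (z ^ δ) ^ j * y ^ j * t := by
  have h1 : t * y * t⁻¹ = z ^ δ * y := by rw [hδ]; group
  rw [← ((h.commute y).symm.pow_left δ).mul_pow, ← h1, conj_pow]
  group

theorem pow_mul_of_mul_eq' (h : AdmissiblePair 0 z y) {t : G} {δ : ℕ} (hδ : t * y = z ^ δ * y * t)
    (k : ℕ) : t ^ k * y = (z ^ δ) ^ k * y * t ^ k := by
  have h1 : y⁻¹ * t * y⁻¹⁻¹ = z ^ δ * t := by
    rw [inv_inv, mul_assoc, hδ, mul_assoc, ← mul_assoc, ((h.commute y⁻¹).pow_right δ).eq]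
    group
  have h2 : y⁻¹ * t ^ k * y⁻¹⁻¹ = (z ^ δ) ^ k * t ^ k := by
    rw [← conj_pow, h1, ((h.commute t).symm.pow_left δ).mul_pow]
  rw [inv_inv, mul_assoc, inv_mul_eq_iff_eq_mul] at h2
  rw [h2, ← mul_assoc, (((h.commute y).pow_right δ).pow_right k).eq]

variable [Finite G]

/-- The case of an extension of `C_3` by `C_3 × C_3` which splits. -/
theorem isColourableGroup_of_card_eq (h : AdmissiblePair 0 z y) {t : G} {δ : ℕ}
    (hcard : Nat.card G = 27) (hgen : ∀ g : G, ∃ i j k : ℕ, g = z ^ i * y ^ j * t ^ k)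
    (hδ : t * y = z ^ δ * y * t) (ht : t ^ 3 = 1) : IsColourableGroup G := by
  by_cases h1 : z ^ δ = 1
  · exact isColourableGroup_of_isCodeColouring (δ := 0) (ε := 0) h.zero_left_pow_three h.commute
      h.pow_three hcard hgen (by rw [hδ, h1, pow_zero]) (by rw [ht, pow_zero])
      exists_isCodeColouring_zero_zero
  · refine isColourableGroup_of_isCodeColouring (z := z ^ δ) (y := y) (t := t) (δ := 1) (ε := 0) ?_
      (fun g => (h.commute g).pow_right δ) h.pow_three hcard (fun g => ?_)
      (by rw [hδ, pow_one]) (by rw [ht, pow_zero]) exists_isCodeColouring_one_zero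
    · rw [← pow_mul, mul_comm, pow_mul, h.zero_left_pow_three, one_pow]
    · obtain ⟨i, j, k, rfl⟩ := hgen g
      have hz := mem_zpowers_of_mem_zpowers_of_ne_one h.zero_left_pow_three
        (pow_mem (Subgroup.mem_zpowers z) δ) h1
      obtain ⟨i', e⟩ := mem_zpowers_iff_exists_natPow.1 (pow_mem hz i)
      exact ⟨i', j, k, by rw [← e]⟩

/-- The case of a split extension of a cyclic group of order at least `9` by `C_3 × C_3`: the elements
of order `3` of the cyclic group and `z` generate a central subgroup with a commutative noncyclic
quotient. -/
theorem isColourableGroup_of_pow_eq_one (hG : IsPGroup 3 G)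
    (ih : ∀ (H : Type u) [Group H] [Finite H], Nat.card H < Nat.card G → IsPGroup 3 H →
      ¬ IsCyclic H → ¬ IsModularGroup H → IsColourableGroup H)
    (h : AdmissiblePair 0 z y) {t : G} {δ m : ℕ}
    (hgen : ∀ g : G, ∃ i j k : ℕ, g = z ^ i * y ^ j * t ^ k)
    (hδ : t * y = z ^ δ * y * t) (ht : ∀ k : ℤ, t ^ k ∈ h.subgroup ↔ (3 ^ (m + 2) : ℤ) ∣ k)
    (hw : t ^ 3 ^ (m + 2) = 1) : IsColourableGroup G := by
  have hz3 := h.zero_left_pow_three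
  let s := t ^ 3 ^ (m + 1)
  have hs3 : s ^ 3 = 1 := by rw [← pow_mul, ← pow_succ]; exact hw
  have hsN : s ∉ h.subgroup := fun hs => by
    have := (ht (3 ^ (m + 1) : ℕ)).1 (by rw [zpow_natCast]; exact hs)
    rw [show ((3 : ℤ) ^ (m + 2)) = ((3 ^ (m + 2) : ℕ) : ℤ) by push_cast; rfl, Int.natCast_dvd_natCast,
      Nat.pow_dvd_pow_iff_le_right (by norm_num)] at this
    omega
  have hsc : ∀ g, Commute g s := by
    have hys : Commute y s := by
      have := h.pow_mul_of_mul_eq' hδ (3 ^ (m + 1))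
      rw [← pow_mul, show δ * 3 ^ (m + 1) = 3 * (δ * 3 ^ m) by ring, pow_mul, hz3, one_pow,
        one_mul] at this
      exact this.symm
    intro g
    obtain ⟨i, j, k, rfl⟩ := hgen g
    exact (((h.commute s).symm.pow_left i).mul_left (hys.pow_left j)).mul_left
      (((Commute.refl t).pow_right _).pow_left k)
  have hp : AdmissiblePair 0 z s := by
    refine .of_orderOf_eq_three (by simpa using h.orderOf_left) h.commute hs3
      (fun hs => hsN (Subgroup.zpowers_le.2 h.left_mem hs))
      fun g => ⟨1, one_mem _, by rw [(hsc g).eq]; group⟩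
  have hcomm : ∀ a b : G ⧸ hp.subgroup, Commute a b := by
    refine commute_quotient_of_generators (N := Subgroup.zpowers z) (a := y) (b := t)
      (fun g => ?_) ?_ fun x hx g => ⟨1, one_mem _, ?_⟩
    · obtain ⟨i, j, k, rfl⟩ := hgen g
      refine ⟨j, k, z ^ i, pow_mem (Subgroup.mem_zpowers z) i, ?_⟩
      rw [mul_assoc, ((h.commute _).pow_right i).eq]
    · rw [hδ]
      have : z ^ δ * y * t * t⁻¹ * y⁻¹ = z ^ δ := by group
      rw [this]
      exact pow_mem hp.left_mem δ
    · obtain ⟨i, rfl⟩ := hx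
      have := ((h.commute g).zpow_right i).eq
      simp [this]
  have hmem : ∀ x ∈ hp.subgroup, ∃ e : ℕ, ∃ n ∈ h.subgroup, x = n * t ^ (3 ^ (m + 1) * e) := by
    intro x hx
    obtain ⟨i, e, rfl⟩ := hp.mem_subgroup.1 hx
    exact ⟨e, z ^ i, pow_mem h.left_mem i, by rw [pow_mul]⟩
  refine hp.isColourableGroup_of_commute hG ih hcomm fun hcyc => ?_
  -- In a cyclic quotient one of the images of `y` and `t` would be a power of the other.
  rcases mem_zpowers_or_mem_zpowers_of_isCyclic (hG.to_quotient hp.subgroup)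
    (QuotientGroup.mk' _ y) (QuotientGroup.mk' _ t) with h1 | h1
  · obtain ⟨k, hk⟩ := h1
    have h2 : (t ^ k)⁻¹ * y ∈ hp.subgroup := QuotientGroup.eq.1 hk
    obtain ⟨i, e, he⟩ := hp.mem_subgroup.1 h2
    have h3 : t ^ (k + (3 ^ (m + 1) * e : ℕ)) = y * (z ^ i)⁻¹ := by
      rw [inv_mul_eq_iff_eq_mul] at he
      rw [he, zpow_add, zpow_natCast, pow_mul]
      have : t ^ k * (z ^ i * s ^ e) * (z ^ i)⁻¹ = t ^ k * s ^ e := by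
        rw [mul_assoc, ← ((h.commute (s ^ e)).pow_right i).eq]; group
      exact this.symm
    have h4 := (ht _).1 (h3 ▸ mul_mem h.right_mem (inv_mem (pow_mem h.left_mem i)))
    obtain ⟨d, hd⟩ := h4
    rw [hd, zpow_mul, show ((3 : ℤ) ^ (m + 2)) = ((3 ^ (m + 2) : ℕ) : ℤ) by push_cast; rfl,
      zpow_natCast, hw, one_zpow, eq_comm, mul_inv_eq_one] at h3
    exact h.notMem (h3 ▸ pow_mem (Subgroup.mem_zpowers z) i)
  · obtain ⟨k, hk⟩ := h1
    have h2 : (y ^ k)⁻¹ * t ∈ hp.subgroup := QuotientGroup.eq.1 hk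
    obtain ⟨e, n, hn, he⟩ := hmem _ h2
    have h3 : t ^ (1 - (3 ^ (m + 1) * e : ℕ) : ℤ) = y ^ k * n := by
      rw [inv_mul_eq_iff_eq_mul, ← mul_assoc] at he
      rw [sub_eq_add_neg, zpow_add, zpow_one, zpow_neg, zpow_natCast]
      exact mul_inv_eq_of_eq_mul he
    have h4 := (ht _).1 (h3 ▸ mul_mem (zpow_mem h.right_mem k) hn)
    have h5 : (3 : ℤ) ∣ 1 - (3 ^ (m + 1) * e : ℕ) := (dvd_pow_self 3 (by omega)).trans h4
    have h6 : (3 : ℤ) ∣ (3 ^ (m + 1) * e : ℕ) := by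
      push_cast
      exact (dvd_pow_self 3 (by omega)).mul_right _
    have := (Int.dvd_iff_dvd_of_dvd_sub h5).2 h6
    norm_num at this

/-- The case of the abelian group `C_{3^(m+2)} × C_3`. -/
theorem isColourableGroup_of_commute_of_pow_ne_one (h : AdmissiblePair 0 z y) {t : G} {m : ℕ}
    (hcard : Nat.card G = 3 ^ (m + 3)) (htc : ∀ g, Commute g t)
    (ht : ∀ k : ℤ, t ^ k ∈ h.subgroup ↔ (3 ^ (m + 1) : ℤ) ∣ k)
    (hw : t ^ 3 ^ (m + 1) ≠ 1) : IsColourableGroup G := by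
  have : Fact (Nat.Prime 3) := ⟨by norm_num⟩
  have hwN : t ^ 3 ^ (m + 1) ∈ h.subgroup := by
    have := (ht (3 ^ (m + 1) : ℕ)).2 (by push_cast; exact dvd_rfl)
    rwa [zpow_natCast] at this
  obtain ⟨y', hy', hyw, hconj, -⟩ := h.exists_complement hwN hw
  have hp : AdmissiblePair (m + 1) t y' := by
    refine ⟨orderOf_eq_prime_pow hw ?_, htc, h.pow_three_of_mem hy', fun hy => ?_, fun g => ?_⟩
    · rw [pow_succ, pow_mul, h.pow_three_of_mem hwN]
    · obtain ⟨k, rfl⟩ := hy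
      obtain ⟨d, rfl⟩ := (ht k).1 hy'
      refine hyw ⟨d, ?_⟩
      change _ = t ^ (3 ^ (m + 1) * d)
      rw [zpow_mul]
      norm_cast
    · obtain ⟨v, hv, e⟩ := hconj g
      obtain ⟨p, rfl⟩ := mem_zpowers_iff_exists_natPow.1 hv
      exact ⟨p, by rw [e, pow_mul]⟩
  have h1 : hp.subgroup = ⊤ := Subgroup.eq_top_of_card_eq _ (by rw [hp.card_subgroup, hcard])
  have : Subsingleton (G ⧸ hp.subgroup) := by
    rw [h1]; exact QuotientGroup.subsingleton_quotient_top
  exact hp.isColourableGroup isColourableGroup_of_subsingleton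

/-- The case of a nonabelian group with a cyclic maximal subgroup: it has order `27` or is
isomorphic to `L_r` for some `r ≥ 4`, which is excluded. -/
theorem isColourableGroup_of_not_commute_of_pow_ne_one (hL : ¬ IsModularGroup G)
    (h : AdmissiblePair 0 z y) {t : G} {δ m : ℕ}
    (hcard : Nat.card G = 3 ^ (m + 3)) (hgen : ∀ g : G, ∃ i j k : ℕ, g = z ^ i * y ^ j * t ^ k)
    (hδ : t * y = z ^ δ * y * t) (hδ1 : z ^ δ ≠ 1) (hwN : t ^ 3 ^ (m + 1) ∈ h.subgroup)
    (hw : t ^ 3 ^ (m + 1) ≠ 1) : IsColourableGroup G := by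
  have hz3 := h.zero_left_pow_three
  set w := t ^ 3 ^ (m + 1) with hwdef
  have hδ3 : (z ^ δ) ^ 3 = 1 := by rw [← pow_mul, mul_comm, pow_mul, hz3, one_pow]
  have hy1 : y ≠ 1 := fun hy => h.notMem (hy ▸ one_mem _)
  -- Being fixed by `t`, the element `w` is a power of `z`.
  have hwz : w ∈ Subgroup.zpowers z := by
    obtain ⟨i, j, e⟩ := h.mem_subgroup.1 hwN
    have h1 : t * w = w * t := ((Commute.refl t).pow_right _).eq
    have h2 : (z ^ δ) ^ j = 1 := by
      rw [e, ← mul_assoc, ((h.commute t).pow_right i).eq, mul_assoc, mul_assoc,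
        h.pow_mul_of_mul_eq hδ, mul_right_inj, mul_assoc] at h1
      simpa using h1
    have h3 : 3 ∣ j := by
      have : Fact (Nat.Prime 3) := ⟨by norm_num⟩
      rw [← orderOf_eq_prime hδ3 hδ1]
      exact orderOf_dvd_of_pow_eq_one h2
    obtain ⟨j, rfl⟩ := h3
    rw [e, pow_mul, h.pow_three, one_pow, mul_one]
    exact pow_mem (Subgroup.mem_zpowers z) i
  have hw3 : w ^ 3 = 1 := h.pow_three_of_mem hwN
  have hzw : z ∈ Subgroup.zpowers w := mem_zpowers_of_mem_zpowers_of_ne_one hz3 hwz hw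
  have hwc : ∀ g, Commute g w := fun g => by
    obtain ⟨i, hi⟩ := hwz
    rw [← hi]
    exact (h.commute g).zpow_right i
  -- Replacing `y` by a power, the commutator of `t` and `y` becomes `w`.
  obtain ⟨f, hf⟩ := mem_zpowers_iff_exists_natPow.1 (Subgroup.zpowers_le.2
    (mem_zpowers_of_mem_zpowers_of_ne_one hz3 (pow_mem (Subgroup.mem_zpowers z) δ) hδ1) hwz)
  have hty : t * y ^ f = w * y ^ f * t := by rw [hf]; exact h.pow_mul_of_mul_eq hδ f
  have hyf1 : y ^ f ≠ 1 := fun e => by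
    rw [e, mul_one, mul_one] at hty
    exact hw (by simpa using hty)
  have hyf : y ∈ Subgroup.zpowers (y ^ f) := mem_zpowers_of_mem_zpowers_of_ne_one h.pow_three
    (pow_mem (Subgroup.mem_zpowers y) f) hyf1
  have hyf3 : (y ^ f) ^ 3 = 1 := pow_three_eq_one_of_mem_zpowers h.pow_three
    (pow_mem (Subgroup.mem_zpowers y) f)
  rcases m with _ | m
  · refine isColourableGroup_of_isCodeColouring (z := w) (y := y ^ f) (t := t) (δ := 1) (ε := 1) hw3
      hwc hyf3 (by rw [hcard]; norm_num) (fun g => ?_) (by rw [hty, pow_one])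
      (by rw [hwdef]; norm_num) exists_isCodeColouring_one_one
    obtain ⟨i, j, k, rfl⟩ := hgen g
    obtain ⟨i', hi⟩ := mem_zpowers_iff_exists_natPow.1 (pow_mem hzw i)
    obtain ⟨j', hj⟩ := mem_zpowers_iff_exists_natPow.1 (pow_mem hyf j)
    exact ⟨i', j', k, by rw [hi, hj]⟩
  · refine (hL ⟨m + 4, by omega, hcard, t, (y ^ f)⁻¹, ⟨?_, ?_, ?_, ?_⟩, hw⟩).elim
    · rw [eq_top_iff]
      intro g _
      obtain ⟨i, j, k, rfl⟩ := hgen g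
      have ht : t ∈ Subgroup.closure {t, (y ^ f)⁻¹} := Subgroup.subset_closure (Or.inl rfl)
      have hyi : (y ^ f)⁻¹ ∈ Subgroup.closure {t, (y ^ f)⁻¹} :=
        Subgroup.subset_closure (Or.inr rfl)
      have hy : y ∈ Subgroup.closure {t, (y ^ f)⁻¹} :=
        Subgroup.zpowers_le.2 (inv_mem_iff.1 hyi) hyf
      have hz : z ∈ Subgroup.closure {t, (y ^ f)⁻¹} := Subgroup.zpowers_le.2
        (show w ∈ _ from pow_mem ht _) hzw
      exact mul_mem (mul_mem (pow_mem hz i) (pow_mem hy j)) (pow_mem ht k)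
    · change t ^ 3 ^ (m + 1 + 1 + 1) = 1
      rw [pow_succ 3, pow_mul]
      exact hw3
    · rw [inv_pow, hyf3, inv_one]
    · rw [inv_inv, pow_add, pow_one]
      change _ = t * w
      rw [mul_assoc, hty, hwc t, mul_assoc w, ← mul_assoc, ((hwc _).eq), mul_assoc]
      group

/-- The induction step for a cyclic quotient by a normal subgroup of type `C_3 × C_3`. -/
theorem isColourableGroup_of_isCyclic (hG : IsPGroup 3 G)
    (ih : ∀ (H : Type u) [Group H] [Finite H], Nat.card H < Nat.card G → IsPGroup 3 H →
      ¬ IsCyclic H → ¬ IsModularGroup H → IsColourableGroup H)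
    (hL : ¬ IsModularGroup G) (h : AdmissiblePair 0 z y) (hQ : IsCyclic (G ⧸ h.subgroup)) :
    IsColourableGroup G := by
  have : Fact (Nat.Prime 3) := ⟨by norm_num⟩
  rcases subsingleton_or_nontrivial (G ⧸ h.subgroup) with hs | hnt
  · exact h.isColourableGroup isColourableGroup_of_subsingleton
  obtain ⟨t, ht⟩ := IsCyclic.exists_generator (α := G ⧸ h.subgroup)
  obtain ⟨t, rfl⟩ := QuotientGroup.mk'_surjective _ t
  obtain ⟨m, hm⟩ : ∃ m, orderOf (QuotientGroup.mk' h.subgroup t) = 3 ^ (m + 1) := by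
    obtain ⟨m, hm⟩ := IsPGroup.iff_orderOf.1 (hG.to_quotient h.subgroup)
      (QuotientGroup.mk' h.subgroup t)
    rcases m with _ | m
    · rw [orderOf_eq_card_of_forall_mem_zpowers ht] at hm
      exact (Finite.one_lt_card.ne' hm).elim
    · exact ⟨m, hm⟩
  have hcard : Nat.card G = 3 ^ (m + 3) := by
    rw [Subgroup.card_eq_card_quotient_mul_card_subgroup h.subgroup, h.card_subgroup,
      ← orderOf_eq_card_of_forall_mem_zpowers ht, hm, ← pow_add]
  have htN : ∀ k : ℤ, t ^ k ∈ h.subgroup ↔ (3 ^ (m + 1) : ℤ) ∣ k := fun k => by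
    have h1 : t ^ k ∈ h.subgroup ↔ QuotientGroup.mk' h.subgroup t ^ k = 1 :=
      (QuotientGroup.eq_one_iff (t ^ k)).symm
    rw [h1, ← orderOf_dvd_iff_zpow_eq_one, hm]
    norm_cast
  have hgen : ∀ g : G, ∃ i j k : ℕ, g = z ^ i * y ^ j * t ^ k := fun g => by
    obtain ⟨k, hk⟩ := mem_zpowers_iff_exists_natPow.1 (ht (g : G ⧸ h.subgroup))
    have h1 : (t ^ k)⁻¹ * g ∈ h.subgroup := QuotientGroup.eq.1 hk.symm
    obtain ⟨i, j, e⟩ := h.mem_subgroup.1 (h.normal_subgroup.mem_comm h1)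
    exact ⟨i, j, k, by rw [← e]; group⟩
  obtain ⟨δ, hδ⟩ : ∃ δ : ℕ, t * y = z ^ δ * y * t := by
    obtain ⟨δ, e⟩ := h.conj t
    refine ⟨δ, ?_⟩
    rw [pow_zero, one_mul, ((h.commute y).pow_right δ).eq] at e
    rw [← e]; group
  have hwN : t ^ 3 ^ (m + 1) ∈ h.subgroup := by
    have := (htN (3 ^ (m + 1) : ℕ)).2 (by push_cast; exact dvd_rfl)
    rwa [zpow_natCast] at this
  by_cases hw : t ^ 3 ^ (m + 1) = 1
  · rcases m with _ | m
    · exact h.isColourableGroup_of_card_eq (by rw [hcard]; norm_num) hgen hδ (by simpa using hw)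
    · exact h.isColourableGroup_of_pow_eq_one hG ih hgen hδ htN hw
  by_cases hδ1 : z ^ δ = 1
  · refine h.isColourableGroup_of_commute_of_pow_ne_one hcard (fun g => ?_) htN hw
    rw [hδ1, one_mul] at hδ
    obtain ⟨i, j, k, rfl⟩ := hgen g
    exact (((h.commute t).symm.pow_left i).mul_left ((show Commute y t from hδ.symm).pow_left j)).mul_left
      ((Commute.refl t).pow_left k)
  · exact h.isColourableGroup_of_not_commute_of_pow_ne_one hL hcard hgen hδ hδ1 hwN hw

end AdmissiblePair

/-! ### The colourability of `3`-groups -/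

/-- Noncyclic `3`-groups other than the groups `L_r` are colourable: induction on the order, passing
to the quotient by a normal subgroup of type `C_3 × C_3` whenever this quotient is neither cyclic nor
some `L_r`. -/
theorem isColourableGroup_of_not_isCyclic (G : Type u) [Group G] [Finite G] (hG : IsPGroup 3 G)
    (hnc : ¬ IsCyclic G) (hL : ¬ IsModularGroup G) : IsColourableGroup G := by
  induction hn : Nat.card G using Nat.strong_induction_on generalizing G with
  | _ n ih =>
    have ih' : ∀ (H : Type u) [Group H] [Finite H], Nat.card H < Nat.card G → IsPGroup 3 H →
        ¬ IsCyclic H → ¬ IsModularGroup H → IsColourableGroup H :=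
      fun H _ _ hlt hH hc hm => ih _ (hn ▸ hlt) H hH hc hm rfl
    obtain ⟨z, y, h⟩ := exists_admissiblePair G hG hnc
    by_cases hc : IsCyclic (G ⧸ h.subgroup)
    · exact h.isColourableGroup_of_isCyclic hG ih' hL hc
    by_cases hm : IsModularGroup (G ⧸ h.subgroup)
    · exact h.isColourableGroup_of_isModularGroup hG ih' hm
    · refine h.isColourableGroup (ih' _ ?_ (hG.to_quotient _) hc hm)
      rw [Subgroup.card_eq_card_quotient_mul_card_subgroup h.subgroup, h.card_subgroup]
      exact lt_mul_of_one_lt_right Nat.card_pos (by norm_num)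

theorem IsModularGroup.exists_nonempty_mulEquiv {G : Type*} [Group G] [Finite G]
    (h : IsModularGroup G) : ∃ r : ℕ, 4 ≤ r ∧ Nonempty (G ≃* GroupL r) := by
  obtain ⟨r, hr, hcard, a, b, h, -⟩ := h
  exact ⟨r, hr, h.nonempty_mulEquiv (by omega) hcard⟩

/-- A group isomorphic to some `L_r` has a cyclic maximal subgroup. -/
theorem exists_isCoatom_isCyclic_of_mulEquiv {G : Type*} [Group G] [Finite G] [Nontrivial G] {r : ℕ}
    (e : G ≃* GroupL r) : ∃ M : Subgroup G, IsCoatom M ∧ IsCyclic M := by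
  have hp := IsModularPair.groupL r
  refine IsModularPair.exists_isCoatom_isCyclic (r := r) (a := e.symm (PresentedGroup.of 0))
    (b := e.symm (PresentedGroup.of 1)) ⟨?_, ?_, ?_, ?_⟩
  · have := congrArg (Subgroup.map e.symm.toMonoidHom) hp.closure_eq_top
    rw [MonoidHom.map_closure, Set.image_pair] at this
    refine this.trans ?_
    rw [← MonoidHom.range_eq_map, MonoidHom.range_eq_top]
    exact e.symm.surjective
  · rw [← map_pow, hp.pow_left, map_one]
  · rw [← map_pow, hp.pow_right, map_one]
  · rw [← map_mul, ← map_inv, ← map_mul, hp.conj, map_pow]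

theorem mainTheorem1 (G : Type*) [Group G] [Finite G] (hG : IsPGroup 3 G) :
    ((¬ IsCyclic G ∧ ∀ r : ℕ, 4 ≤ r → IsEmpty (G ≃* GroupL r)) →
      IsColourableGroup G ∧ (cayleyGraph3 G).chromaticNumber = (Nat.card G : ℕ∞)) ∧
    ((∀ M : Subgroup G, IsCoatom M → ¬ IsCyclic M) →
      IsColourableGroup G ∧ (cayleyGraph3 G).chromaticNumber = (Nat.card G : ℕ∞)) := by
  have h1 : (¬ IsCyclic G ∧ ∀ r : ℕ, 4 ≤ r → IsEmpty (G ≃* GroupL r)) → IsColourableGroup G := by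
    rintro ⟨hnc, hr⟩
    refine isColourableGroup_of_not_isCyclic G hG hnc fun hm => ?_
    obtain ⟨r, hr4, ⟨e⟩⟩ := hm.exists_nonempty_mulEquiv
    exact (hr r hr4).elim e
  have h2 : (∀ M : Subgroup G, IsCoatom M → ¬ IsCyclic M) → IsColourableGroup G := by
    intro hM
    rcases subsingleton_or_nontrivial G with hs | hnt
    · exact isColourableGroup_of_subsingleton
    refine h1 ⟨fun hc => ?_, fun r _ => ⟨fun e => ?_⟩⟩
    · obtain ⟨M, hM', -⟩ := (eq_top_or_exists_le_coatom (⊥ : Subgroup G)).resolve_left bot_ne_top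
      exact hM M hM' inferInstance
    · obtain ⟨M, hM', hc⟩ := exists_isCoatom_isCyclic_of_mulEquiv e
      exact hM M hM' hc
  exact ⟨fun h => ⟨h1 h, (h1 h).chromaticNumber_cayleyGraph3⟩,
    fun h => ⟨h2 h, (h2 h).chromaticNumber_cayleyGraph3⟩⟩
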